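/- Let $k$ be a field. An algebra over a commutative ring $B$ is a $B$-module $\mathcal A$ with a $B$-bilinear product, not necessarily associative, commutative or unital; its centroid is $C_B(\mathcal A)=\{\chi\in\mathrm{End}_B(\mathcal A):\chi(xy)=\chi(x)y=x\chi(y)\ \text{for all } x,y\in\mathcal A\}$. The algebra $\mathcal A$ is *central* if $b\mapsto(x\mapsto bx)$ is an isomorphism $B\to C_B(\mathcal A)$; *simple* if $\mathcal A\mathcal A\neq 0$ and its only ideals are $0$ and $\mathcal A$; *prime* if $\mathcal I\mathcal J=0$ implies $\mathcal I=0$ or $\mathcal J=0$ for ideals $\mathcal I,\mathcal J$; *semiprime* if $\mathcal I\mathcal I=0$ implies $\mathcal I=0$ for ideals $\mathcal I$; *pfgc* if it is nonzero, perfect ($\mathcal A\mathcal A=\mathcal A$) and finitely generated as a module over its centroid (which is then commutative). "Algebra" without further specification means algebra over $k$, and we write $C(\mathcal A)=C_k(\mathcal A)$. Let $\mathbf V$ be a variety over $k$, i.e. the class of all algebras satisfying a given set of identities in the free nonassociative $k$-algebra on countably many symbols. Assume that $\mathbf V$ is homogeneous: the ideal of all identities satisfied by all algebras in $\mathbf V$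 contains, with each of its elements, the homogeneous components of that element with respect to the degrees in each symbol. For a field extension $K/k$, a $\mathbf V$-algebra over $K$ is a $K$-algebra which, regarded as a $k$-algebra, is in $\mathbf V$. Assume: (S) for every field extension $K/k$, every finite dimensional semiprime $\mathbf V$-algebra over $K$ is a direct sum of simple algebras over $K$. Let $\mathbf X$ be a set of archetypes for $\mathbf V$, i.e. a set of finite dimensional central simple $\mathbf V$-algebras over $k$ such that (A1) if $K/k$ is an algebraically closed field extension and $\mathcal A$ is a finite dimensional central simple $\mathbf V$-algebra over $K$, then $\mathcal A\simeq_K\mathcal X\otimes_k K$ for some $\mathcal X\in\mathbf X$; (A2) if $K/k$ is a field extension, $\mathcal X,\mathcal X'\in\mathbf X$ and $\mathcal X\otimes_k K\simeq_K\mathcal X'\otimes_k K$, then $\mathcal X=\mathcal X'$. A prime pfgc $\mathbf V$-algebra $\mathcal A$ is said to be of *type* $\mathcal X\in\mathbf X$ if $C(\mathcal A)$ has an injective unital $k$-algebra homomorphism into some algebraically closed extension field of $k$ and, for every such homomorphism $C(\mathcal A)\hookrightarrow K$, the algebra $\mathcal X$ is the unique element of $\mathbf X$ with $\mathcal A\otimes_{C(\mathcal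 A)}K\simeq_K\mathcal X\otimes_k K$. If $\Sigma=\{\mathcal A_{\bar\imath}\}_{\bar\imath\in\mathbb Z/m\mathbb Z}$ is a $\mathbb Z/m\mathbb Z$-grading of an algebra $\mathcal A$ ($m\ge 1$), the *loop algebra* of $\Sigma$ based on $\mathcal A$ is the $k$-subalgebra $L(\mathcal A,\Sigma)=\bigoplus_{i\in\mathbb Z}\mathcal A_{\bar\imath}\otimes_k z^i$ of $\mathcal A\otimes_k k[z^{\pm1}]$. For $n\ge 0$, an algebra $\mathcal L$ is an *$n$-step loop algebra based on $\mathcal A$* if there are algebras $\mathcal L_0=\mathcal A,\mathcal L_1,\dots,\mathcal L_n=\mathcal L$ such that, for $1\le p\le n$, $\mathcal L_p=L(\mathcal L_{p-1},\Sigma_p)$ for some grading $\Sigma_p$ of $\mathcal L_{p-1}$ by $\mathbb Z/m_p\mathbb Z$ with $m_p\ge 1$. **Corollary.** If $\mathcal X\in\mathbf X$ and $\mathcal L$ is an $n$-step loop algebra based on $\mathcal X$, then $\mathcal L$ is a prime pfgc $\mathbf V$-algebra of type $\mathcal X$. If further $\mathcal X'\in\mathbf X$ and $\mathcal L'$ is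 an $n'$-step loop algebra based on $\mathcal X'$, then $$\mathcal L\simeq_k\mathcal L'\implies \mathcal X=\mathcal X'\ \text{ and }\ n=n'.$$ -/

import Mathlib

open scoped TensorProduct

universe u

namespace LoopAlg

/-! ### Nonassociative algebras -/

section Basic

variable (B : Type u) [CommRing B] (A : Type u) [NonUnitalNonAssocRing A] [Module B A]
  [IsScalarTower B A A] [SMulCommClass B A A]

/-- `A` and `A'` are isomorphic as `B`-algebras. -/
def AlgIso (B : Type u) [CommRing B] (A A' : Type u) [NonUnitalNonAssocRing A] [Module B A]
    [NonUnitalNonAssocRing A'] [Module B A'] : Prop :=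
  ∃ e : A ≃ₗ[B] A', ∀ x y : A, e (x * y) = e x * e y

variable {A} in
/-- A `B`-submodule of `A` that is a (two-sided) ideal of the `B`-algebra `A`. -/
def IsIdeal (I : Submodule B A) : Prop :=
  ∀ x ∈ I, ∀ a : A, a * x ∈ I ∧ x * a ∈ I

/-- The `B`-algebra `A` is prime: `I J = 0` implies `I = 0` or `J = 0`, for ideals `I`, `J`. -/
def IsPrimeAlg : Prop :=
  ∀ I J : Submodule B A, IsIdeal B I → IsIdeal B J →
    (∀ x ∈ I, ∀ y ∈ J, x * y = 0) → I = ⊥ ∨ J = ⊥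

/-- The `B`-algebra `A` is semiprime: `I I = 0` implies `I = 0`, for ideals `I`. -/
def IsSemiprimeAlg : Prop :=
  ∀ I : Submodule B A, IsIdeal B I → (∀ x ∈ I, ∀ y ∈ I, x * y = 0) → I = ⊥

/-- The `B`-algebra `A` is simple: `A A ≠ 0`, and the only ideals are `0` and `A`. -/
def IsSimpleAlg : Prop :=
  (∃ x y : A, x * y ≠ 0) ∧ ∀ I : Submodule B A, IsIdeal B I → I = ⊥ ∨ I = ⊤

/-- The `B`-algebra `A` is perfect: every element is a sum of products. -/
def IsPerfectAlg : Prop :=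
  Submodule.span B (Set.range fun p : A × A => p.1 * p.2) = ⊤

/-- The centroid of the `B`-algebra `A`, as a `B`-subalgebra of `End_B(A)`. -/
def centroid : Subalgebra B (Module.End B A) where
  carrier := {χ | ∀ x y : A, χ (x * y) = χ x * y ∧ χ (x * y) = x * χ y}
  mul_mem' := by
    intro χ ψ hχ hψ x y
    simp only [Module.End.mul_apply]
    exact ⟨by rw [(hψ x y).1, (hχ _ _).1], by rw [(hψ x y).2, (hχ _ _).2]⟩
  add_mem' := by
    intro χ ψ hχ hψ x y
    simp only [LinearMap.add_apply]
    exact ⟨by rw [(hψ x y).1, (hχ x y).1, add_mul], by rw [(hψ x y).2, (hχ x y).2, mul_add]⟩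
  algebraMap_mem' := by
    intro b x y
    simp only [Module.algebraMap_end_apply]
    exact ⟨(smul_mul_assoc b x y).symm, (mul_smul_comm b x y).symm⟩

/-- The `B`-algebra `A` is central: `b ↦ (x ↦ b x)` is an isomorphism of `B` onto the centroid. -/
def IsCentralAlg : Prop :=
  Function.Bijective (algebraMap B (centroid B A))

instance : IsScalarTower (centroid B A) A A where
  smul_assoc χ x y := ((χ.2 x y).1).symm

instance : SMulCommClass (centroid B A) A A where
  smul_comm χ x y := (χ.2 x y).2

/-- The algebra `A` is pfgc: nonzero, perfect, and finitely generated over its centroid. -/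
structure IsPfgc : Prop where
  nontrivial : Nontrivial A
  perfect : IsPerfectAlg B A
  finite : Module.Finite (centroid B A) A

variable {B A} in
theorem centroid_mul_comm (h : IsPerfectAlg B A) (χ ψ : centroid B A) : χ * ψ = ψ * χ := by
  apply Subtype.ext
  have key : Set.EqOn (χ * ψ).1 (ψ * χ).1 (Set.range fun p : A × A => p.1 * p.2) := by
    rintro _ ⟨⟨x, y⟩, rfl⟩
    change χ.1 (ψ.1 (x * y)) = ψ.1 (χ.1 (x * y))
    rw [(ψ.2 x y).2, (χ.2 x _).1, (χ.2 x y).1, (ψ.2 _ y).2]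
  exact LinearMap.ext_on h key

variable {B A} in
/-- The centroid of a perfect algebra is a commutative ring. -/
abbrev centroidCommRing (h : IsPerfectAlg B A) : CommRing (centroid B A) :=
  { Subalgebra.toRing (centroid B A) with mul_comm := centroid_mul_comm h }

end Basic

/-- An algebra over `B`: a `B`-module with a `B`-bilinear product, not necessarily associative,
commutative or unital. -/
structure NAlg (B : Type u) [CommRing B] : Type (u + 1) where
  carrier : Type u
  [ring : NonUnitalNonAssocRing carrier]
  [module : Module B carrier]
  [tower : IsScalarTower B carrier carrier]
  [comm : SMulCommClass B carrier carrier]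

instance (B : Type u) [CommRing B] : CoeSort (NAlg B) (Type u) := ⟨NAlg.carrier⟩

attribute [instance] NAlg.ring NAlg.module NAlg.tower NAlg.comm

/-! ### Varieties and archetypes -/

section Varieties

variable (k : Type u) [Field k]

/-- The class (variety) of algebras defined by a set `V` of identities in the free nonassociative
algebra over `k` on countably many symbols: `A` satisfies every identity in `V`. -/
def IsVAlg (V : Set (FreeNonUnitalNonAssocAlgebra k ℕ)) (A : Type u) [NonUnitalNonAssocRing A]
    [Module k A] [IsScalarTower k A A] [SMulCommClass k A A] : Prop :=
  ∀ f ∈ V, ∀ a : ℕ → A, FreeNonUnitalNonAssocAlgebra.lift k a f = 0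

/-- The ideal of all identities satisfied by all algebras in the variety defined by `V`. -/
def identities (V : Set (FreeNonUnitalNonAssocAlgebra k ℕ)) :
    Set (FreeNonUnitalNonAssocAlgebra k ℕ) :=
  {f | ∀ A : NAlg.{u} k, IsVAlg k V A → IsVAlg k {f} A}

/-- The type (multidegree) of a nonassociative word: its degree in each of the symbols. -/
noncomputable def multidegree : FreeMagma ℕ → ℕ →₀ ℕ
  | .of i => Finsupp.single i 1
  | .mul v w => multidegree v + multidegree w

open Classical in
/-- The homogeneous component of type `d` of a nonassociative polynomial. -/
noncomputable def homogComponent (d : ℕ →₀ ℕ) (f : FreeNonUnitalNonAssocAlgebra k ℕ) :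
    FreeNonUnitalNonAssocAlgebra k ℕ :=
  MonoidAlgebra.ofCoeff (f.coeff.filter fun w => multidegree w = d)

/-- The variety defined by `V` is homogeneous: its ideal of identities contains all homogeneous
components of each of its elements. -/
def IsHomogeneousVariety (V : Set (FreeNonUnitalNonAssocAlgebra k ℕ)) : Prop :=
  ∀ f ∈ identities k V, ∀ d : ℕ →₀ ℕ, homogComponent k d f ∈ identities k V

/-- Axiom (S): for each field extension `K` of `k`, every finite dimensional semiprime `V`-algebra
over `K` is a (finite) direct sum of simple algebras over `K`. -/
def AxiomS (V : Set (FreeNonUnitalNonAssocAlgebra k ℕ)) : Prop :=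
  ∀ (K : Type u) [Field K] [Algebra k K] (A : Type u) [NonUnitalNonAssocRing A] [Module K A]
    [IsScalarTower K A A] [SMulCommClass K A A] [Module k A] [IsScalarTower k K A]
    [IsScalarTower k A A] [SMulCommClass k A A],
    Module.Finite K A → IsSemiprimeAlg K A → IsVAlg k V A →
    ∃ (r : ℕ) (S : Fin r → NAlg.{u} K), (∀ i, IsSimpleAlg K (S i)) ∧
      AlgIso K A (∀ i, S i)

/-- `X` is a set of archetypes for the variety defined by `V`. -/
structure IsArchetypes (V : Set (FreeNonUnitalNonAssocAlgebra k ℕ)) (X : Set (NAlg.{u} k)) :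
    Prop where
  mem : ∀ Y ∈ X, Module.Finite k Y ∧ IsCentralAlg k Y ∧ IsSimpleAlg k Y ∧ IsVAlg k V Y
  /-- Axiom (A1). -/
  exists_iso : ∀ (K : Type u) [Field K] [Algebra k K] [IsAlgClosed K]
    (A : Type u) [NonUnitalNonAssocRing A] [Module K A]
    [IsScalarTower K A A] [SMulCommClass K A A] [Module k A] [IsScalarTower k K A]
    [IsScalarTower k A A] [SMulCommClass k A A],
    Module.Finite K A → IsCentralAlg K A → IsSimpleAlg K A → IsVAlg k V A →
    ∃ Y ∈ X, AlgIso K A (K ⊗[k] Y)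
  /-- Axiom (A2). -/
  eq_of_iso : ∀ (K : Type u) [Field K] [Algebra k K], ∀ Y ∈ X, ∀ Y' ∈ X,
    AlgIso K (K ⊗[k] Y) (K ⊗[k] Y') → Y = Y'

variable {k} in
/-- Given a `k`-algebra homomorphism `φ : C(A) → K`, the `K`-algebras `A ⊗_{C(A)} K` and `Y ⊗_k K`
are isomorphic. -/
def CentroidExtIso {A : Type u} [NonUnitalNonAssocRing A] [Module k A] [IsScalarTower k A A]
    [SMulCommClass k A A] (h : IsPerfectAlg k A) {K : Type u} [Field K] [Algebra k K]
    (φ : centroid k A →ₐ[k] K) (Y : NAlg.{u} k) : Prop :=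
  letI : CommRing (centroid k A) := centroidCommRing h
  letI : Algebra (centroid k A) K := φ.toRingHom.toAlgebra
  AlgIso K (K ⊗[centroid k A] A) (K ⊗[k] Y)

variable {k} in
/-- `Y` is the type of the (perfect) algebra `A` relative to `X`: it is the unique member of `X`
with `A ⊗_{C(A)} K ≃ Y ⊗_k K` for one, equivalently every, embedding over `k` of the centroid
`C(A)` into an algebraically closed extension `K` of `k`. -/
structure HasType (X : Set (NAlg.{u} k)) {A : Type u} [NonUnitalNonAssocRing A] [Module k A]
    [IsScalarTower k A A] [SMulCommClass k A A] (h : IsPerfectAlg k A) (Y : NAlg.{u} k) :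
    Prop where
  mem : Y ∈ X
  exists_embedding : ∃ (K : Type u) (_ : Field K) (_ : Algebra k K) (_ : IsAlgClosed K)
    (φ : centroid k A →ₐ[k] K), Function.Injective φ
  iso : ∀ (K : Type u) [Field K] [Algebra k K] [IsAlgClosed K] (φ : centroid k A →ₐ[k] K),
    Function.Injective φ → CentroidExtIso h φ Y
  unique : ∀ (K : Type u) [Field K] [Algebra k K] [IsAlgClosed K] (φ : centroid k A →ₐ[k] K),
    Function.Injective φ → ∀ Y' ∈ X, CentroidExtIso h φ Y' → Y' = Y

end Varieties

/-! ### Loop algebras -/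

section Loop

variable {k : Type u} [Field k]

/-- A `ℤ/mℤ`-grading of the `k`-algebra `A`. -/
structure Grading (k : Type u) [Field k] (A : Type u) [NonUnitalNonAssocRing A] [Module k A]
    (m : ℕ) where
  piece : ZMod m → Submodule k A
  isInternal : DirectSum.IsInternal piece
  mul_mem : ∀ {i j : ZMod m} {a b : A}, a ∈ piece i → b ∈ piece j → a * b ∈ piece (i + j)

/-- The loop algebra of the grading `Σ` based on `A`: the subalgebra `⨁ i : ℤ, A_i ⊗ z ^ i` of
`A ⊗ k[z, z⁻¹]`, where the index of `A_i` is taken modulo `m`. -/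
noncomputable def loopSubalgebra {A : Type u} [NonUnitalNonAssocRing A] [Module k A]
    [IsScalarTower k A A] [SMulCommClass k A A] {m : ℕ} (G : Grading k A m) :
    NonUnitalSubalgebra k (A ⊗[k] LaurentPolynomial k) :=
  { Submodule.span k {x | ∃ (i : ℤ) (a : A), a ∈ G.piece (i : ZMod m) ∧
      x = a ⊗ₜ[k] (LaurentPolynomial.T i : LaurentPolynomial k)} with
    mul_mem' := by
      intro x y hx hy
      induction hx using Submodule.span_induction with
      | zero => simp
      | add x x' _ _ h h' => simpa [add_mul] using Submodule.add_mem _ h h'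
      | smul c x _ h => simpa [smul_mul_assoc] using Submodule.smul_mem _ c h
      | mem x hx =>
        obtain ⟨i, a, ha, rfl⟩ := hx
        induction hy using Submodule.span_induction with
        | zero => simp
        | add y y' _ _ h h' => simpa [mul_add] using Submodule.add_mem _ h h'
        | smul c y _ h => simpa [mul_smul_comm] using Submodule.smul_mem _ c h
        | mem y hy =>
          obtain ⟨j, b, hb, rfl⟩ := hy
          refine Submodule.subset_span ⟨i + j, a * b, ?_, ?_⟩
          · rw [Int.cast_add]
            exact G.mul_mem ha hb
          · rw [Algebra.TensorProduct.tmul_mul_tmul, LaurentPolynomial.T_add] }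

/-- The loop algebra of a grading, as an algebra over `k`. -/
noncomputable def loopAlgebra (A : NAlg.{u} k) {m : ℕ} (G : Grading k A m) : NAlg.{u} k where
  carrier := loopSubalgebra G

/-- `IsIteratedLoop A n L`: `L` is an `n`-step loop algebra based on `A`, i.e. it is the last term
of a sequence `L₀ = A, L₁, …, Lₙ` in which each `Lₚ₊₁` is the loop algebra of a grading of `Lₚ` by
the integers modulo some positive integer. -/
inductive IsIteratedLoop (A : NAlg.{u} k) : ℕ → NAlg.{u} k → Prop
  | zero : IsIteratedLoop A 0 A
  | succ {n : ℕ} {L : NAlg.{u} k} (hL : IsIteratedLoop A n L) {m : ℕ} (hm : 0 < m)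
      (G : Grading k L m) : IsIteratedLoop A (n + 1) (loopAlgebra L G)

end Loop

end LoopAlg

set_option linter.unusedSectionVars false

namespace LoopAlg

/-! ### Homogeneous varieties and commutative scalar extensions. -/

section Variety

variable {k : Type u} [Field k]

/-! An iterated loop algebra `L` based on `X` is a form of `X`. It sits in `S ⊗ X`, where `S` is
obtained from `k` by adjoining an invertible Laurent variable at each of the `n` steps, so that `S`
is a domain of transcendence degree `n`. Let `R ⊆ S` be the ring of scalars preserving the image of
`L`. The property `IsForm`, which is inductive along the steps (`IsForm.loop`), says that `S ⊗ X` is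
`S ⊗_R L`, that `S` is integral over `R`, and that `L` is finitely generated over `R`.

The source of control is that `X` is finite dimensional central simple. By Jacobson density its
multiplication operators generate all of `End_k(X)` (`adjoin_mulOperators_eq_top`), so any
multiplication-stable relation on `S ⊗ X` is stable under rank one operators. This makes every
centroid element of `L` act as a scalar of `S` (`IsSpanningEmbedding.exists_smul_eq`), so that `C(L)
≃ R`, and it makes `L` prime. Moreover, the centroid of a graded algebra decomposes into homogeneous
parts, hence so does `R`; this is what carries the induction through a loop step.

For the type, an embedding of `C(L) = R` into an algebraically closed `K` extends to `S` by
integrality, and base change of `S ⊗_R L ≃ S ⊗ X` along `S → K` gives `K ⊗_R L ≃ K ⊗ X`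
(`IsForm.algIso_tensor`). Axiom (A2) gives uniqueness, and also `X = X'` for isomorphic loop
algebras. Finally `n` is the transcendence degree of `C(L)`, since `S` is integral over `R`.
Membership in the variety holds because homogeneous identities survive commutative scalar extension
(`IsVAlg.tensor`). -/

theorem IsVAlg.of_injective {V : Set (FreeNonUnitalNonAssocAlgebra k ℕ)}
    {A B : Type u} [NonUnitalNonAssocRing A] [Module k A] [IsScalarTower k A A]
    [SMulCommClass k A A] [NonUnitalNonAssocRing B] [Module k B] [IsScalarTower k B B]
    [SMulCommClass k B B] (hB : IsVAlg k V B) (φ : A →ₙₐ[k] B) (hφ : Function.Injective φ) :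
    IsVAlg k V A := by
  intro f hf a
  apply hφ
  have h : φ.comp (FreeNonUnitalNonAssocAlgebra.lift k a) =
      FreeNonUnitalNonAssocAlgebra.lift k (φ ∘ a) := by
    apply FreeNonUnitalNonAssocAlgebra.hom_ext
    intro x
    simp
  rw [map_zero, ← hB f hf (φ ∘ a), ← h]
  rfl

/-- The nonassociative word `w`, as an element of the free algebra. -/
noncomputable def word (k : Type u) [Field k] (w : FreeMagma ℕ) :
    FreeNonUnitalNonAssocAlgebra k ℕ := MonoidAlgebra.single w 1

theorem word_mul (v w : FreeMagma ℕ) : word k (v * w) = word k v * word k w := by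
  rw [word, word, word, MonoidAlgebra.single_mul_single, one_mul]

theorem lift_word_of {A : Type u} [NonUnitalNonAssocRing A] [Module k A] [IsScalarTower k A A]
    [SMulCommClass k A A] (a : ℕ → A) (i : ℕ) :
    FreeNonUnitalNonAssocAlgebra.lift k a (word k (.of i)) = a i :=
  FreeNonUnitalNonAssocAlgebra.lift_of_apply k a i

theorem lift_word_tmul {A R : Type u} [NonUnitalNonAssocRing A] [Module k A]
    [IsScalarTower k A A] [SMulCommClass k A A] [CommRing R] [Algebra k R]
    (c : ℕ → A) (r : ℕ → R) (w : FreeMagma ℕ) :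
    FreeNonUnitalNonAssocAlgebra.lift k (fun i => c i ⊗ₜ[k] r i) (word k w) =
      FreeNonUnitalNonAssocAlgebra.lift k c (word k w) ⊗ₜ[k]
        ((multidegree w).prod fun i e => r i ^ e) := by
  induction w with
  | ih1 i =>
    rw [lift_word_of, lift_word_of]
    simp [multidegree]
  | ih2 v w hv hw =>
    change FreeNonUnitalNonAssocAlgebra.lift k _ (word k (v * w)) =
      FreeNonUnitalNonAssocAlgebra.lift k c (word k (v * w)) ⊗ₜ[k] _
    rw [word_mul, map_mul, map_mul, hv, hw, Algebra.TensorProduct.tmul_mul_tmul,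
      show multidegree (v * w) = multidegree v + multidegree w from rfl,
      Finsupp.prod_add_index' (by simp) (by simp [pow_add])]

/-- Words of the same multidegree produce the same monomial in the commuting scalars `r i`, so this
monomial factors out of the whole component. -/
theorem lift_homogComponent_tmul {A R : Type u} [NonUnitalNonAssocRing A] [Module k A]
    [IsScalarTower k A A] [SMulCommClass k A A] [CommRing R] [Algebra k R]
    (c : ℕ → A) (r : ℕ → R) (d : ℕ →₀ ℕ) (f : FreeNonUnitalNonAssocAlgebra k ℕ) :
    FreeNonUnitalNonAssocAlgebra.lift k (fun i => c i ⊗ₜ[k] r i) (homogComponent k d f) =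
      FreeNonUnitalNonAssocAlgebra.lift k c (homogComponent k d f) ⊗ₜ[k]
        (d.prod fun i e => r i ^ e) := by
  classical
  have h : homogComponent k d f =
      ∑ w ∈ f.coeff.support.filter (fun w => multidegree w = d), f.coeff w • word k w := by
    apply MonoidAlgebra.coeff_injective
    rw [homogComponent, MonoidAlgebra.coeff_sum]
    ext w
    simp only [Finsupp.filter_apply, Finsupp.finsetSum_apply, word, MonoidAlgebra.coeff_smul,
      MonoidAlgebra.coeff_single, Finsupp.smul_apply, Finsupp.single_apply]
    simp
    grind
  rw [h, map_sum, map_sum, TensorProduct.sum_tmul]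
  refine Finset.sum_congr rfl fun w hw => ?_
  rw [map_smul, map_smul, lift_word_tmul, (Finset.mem_filter.1 hw).2, TensorProduct.smul_tmul']

theorem sum_homogComponent (f : FreeNonUnitalNonAssocAlgebra k ℕ) :
    ∃ D : Finset (ℕ →₀ ℕ), f = ∑ d ∈ D, homogComponent k d f := by
  classical
  refine ⟨f.coeff.support.image multidegree, ?_⟩
  apply MonoidAlgebra.coeff_injective
  rw [MonoidAlgebra.coeff_sum]
  ext w
  simp only [homogComponent, Finsupp.finsetSum_apply, Finsupp.filter_apply]
  simp
  grind

theorem exists_eq_sum_range_tmul {A R : Type u} [AddCommGroup A] [Module k A]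
    [CommRing R] [Algebra k R] (x : A ⊗[k] R) :
    ∃ (N : ℕ) (c : ℕ → A) (r : ℕ → R), x = ∑ j ∈ Finset.range N, c j ⊗ₜ[k] r j := by
  induction x using TensorProduct.induction_on with
  | zero => exact ⟨0, 0, 0, by simp⟩
  | tmul a r => exact ⟨1, fun _ => a, fun _ => r, by simp⟩
  | add x y hx hy =>
    obtain ⟨N, c, r, rfl⟩ := hx
    obtain ⟨M, c', r', rfl⟩ := hy
    refine ⟨N + M, fun j => if j < N then c j else c' (j - N),
      fun j => if j < N then r j else r' (j - N), ?_⟩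
    rw [Finset.sum_range_add]
    congr 1
    · exact Finset.sum_congr rfl fun j hj => by simp [Finset.mem_range.1 hj]
    · exact Finset.sum_congr rfl fun j hj => by simp

/-- A homogeneous variety is closed under extension by commutative associative algebras. -/
theorem IsVAlg.tensor {V : Set (FreeNonUnitalNonAssocAlgebra k ℕ)}
    (hV : IsHomogeneousVariety k V) {A R : Type u} [NonUnitalNonAssocRing A] [Module k A]
    [IsScalarTower k A A] [SMulCommClass k A A] [CommRing R] [Algebra k R]
    (hA : IsVAlg k V A) : IsVAlg k V (A ⊗[k] R) := by
  intro f hf a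
  choose N c r hcr using fun i => exists_eq_sum_range_tmul (a i)
  -- Each symbol is replaced by a sum of fresh symbols, one for each pure tensor in `a i`.
  -- Evaluating `f` at `a` then becomes evaluating `σ f` at pure tensors; `Nat.pair` keeps the fresh
  -- symbols distinct.
  let σ := FreeNonUnitalNonAssocAlgebra.lift k (fun i => ∑ j ∈ Finset.range (N i),
    FreeNonUnitalNonAssocAlgebra.of k (Nat.pair i j))
  let c' : ℕ → A := fun p => c p.unpair.1 p.unpair.2
  let r' : ℕ → R := fun p => r p.unpair.1 p.unpair.2
  have hσ : σ f ∈ identities k V := by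
    intro B hB g hg b
    obtain rfl : g = σ f := hg
    have h : (FreeNonUnitalNonAssocAlgebra.lift k b).comp σ =
        FreeNonUnitalNonAssocAlgebra.lift k (fun i => FreeNonUnitalNonAssocAlgebra.lift k b
          (σ (FreeNonUnitalNonAssocAlgebra.of k i))) := by
      apply FreeNonUnitalNonAssocAlgebra.hom_ext
      intro x
      simp
    exact (DFunLike.congr_fun h f).trans (hB f hf _)
  have h : (FreeNonUnitalNonAssocAlgebra.lift k (fun p => c' p ⊗ₜ[k] r' p)).comp σ =
      FreeNonUnitalNonAssocAlgebra.lift k a := by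
    apply FreeNonUnitalNonAssocAlgebra.hom_ext
    intro x
    simp [σ, c', r', hcr x]
  obtain ⟨D, hD⟩ := sum_homogComponent (σ f)
  rw [← h]
  change FreeNonUnitalNonAssocAlgebra.lift k _ (σ f) = 0
  rw [hD, map_sum]
  refine Finset.sum_eq_zero fun d _ => ?_
  -- Homogeneity makes each component of the identity `σ f` an identity, so its value in `A`
  -- vanishes.
  rw [lift_homogComponent_tmul, hV _ hσ d ⟨A⟩ hA _ rfl, TensorProduct.zero_tmul]

theorem IsIteratedLoop.isVAlg {V : Set (FreeNonUnitalNonAssocAlgebra k ℕ)}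
    (hV : IsHomogeneousVariety k V) {X L : NAlg.{u} k} {n : ℕ} (h : IsIteratedLoop X n L)
    (hX : IsVAlg k V X) : IsVAlg k V L := by
  induction h with
  | zero => exact hX
  | succ hL hm G ih =>
    exact IsVAlg.of_injective (ih.tensor hV)
      (NonUnitalSubalgebraClass.subtype (loopSubalgebra G)) Subtype.val_injective

end Variety

/-! ### Multiplication algebras of central simple algebras and spanning embeddings. -/

section CentralSimple

variable {k : Type u} [Field k]

/-- The multiplication operators of an algebra. -/
def mulOperators (k : Type u) [Field k] (X : Type u) [NonUnitalNonAssocRing X] [Module k X]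
    [IsScalarTower k X X] [SMulCommClass k X X] : Set (Module.End k X) :=
  Set.range (LinearMap.mulLeft k) ∪ Set.range (LinearMap.mulRight k)

/-- The multiplication algebra of a finite dimensional central simple algebra consists of all
linear endomorphisms. -/
theorem adjoin_mulOperators_eq_top (X : Type u) [NonUnitalNonAssocRing X] [Module k X]
    [IsScalarTower k X X] [SMulCommClass k X X] [Module.Finite k X] (hc : IsCentralAlg k X)
    (hs : IsSimpleAlg k X) : Algebra.adjoin k (mulOperators k X) = ⊤ := by
  set M := Algebra.adjoin k (mulOperators k X) with hM
  have hl (a : X) : LinearMap.mulLeft k a ∈ M := Algebra.subset_adjoin (.inl ⟨a, rfl⟩)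
  have hr (a : X) : LinearMap.mulRight k a ∈ M := Algebra.subset_adjoin (.inr ⟨a, rfl⟩)
  obtain ⟨x, y, hxy⟩ := hs.1
  have : Nontrivial X := ⟨x * y, 0, hxy⟩
  have : IsSimpleModule M X :=
    (isSimpleModule_iff M X).2
      { exists_pair_ne := ⟨⊥, ⊤, bot_ne_top⟩
        eq_bot_or_eq_top := by
          intro N
          have hN : IsIdeal k (N.restrictScalars k) := fun x hx a =>
            ⟨N.smul_mem ⟨_, hl a⟩ hx, N.smul_mem ⟨_, hr a⟩ hx⟩
          refine (hs.2 _ hN).imp (fun h => ?_) (fun h => ?_)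
          · exact (Submodule.restrictScalars_eq_bot_iff k M X).1 h
          · exact (Submodule.restrictScalars_eq_top_iff k M X).1 h }
  rw [eq_top_iff]
  intro g _
  obtain ⟨s, hs'⟩ := Module.Finite.fg_top (R := k) (M := X)
  -- An `M`-linear map commutes with all multiplications, so it lies in the centroid and is a scalar
  -- by centrality. Hence every linear `g` commutes with `Module.End M X`, as the density theorem
  -- requires.
  have hcomm (φ : Module.End M X) (x : X) : g (φ x) = φ (g x) := by
    have hφ : φ.restrictScalars k ∈ centroid k X := by
      intro x y
      exact ⟨φ.map_smul ⟨_, hr y⟩ x, φ.map_smul ⟨_, hl x⟩ y⟩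
    obtain ⟨c, hcφ⟩ := hc.2 ⟨_, hφ⟩
    have h (x : X) : φ x = c • x := by
      have := congrArg (fun χ : centroid k X => χ.1 x) hcφ
      exact this.symm
    rw [h, h, map_smul]
  -- Density only gives agreement on a finite set; a finite spanning set is enough.
  obtain ⟨r, hr⟩ := jacobson_density (R := M) (M := X)
    { toFun := g, map_add' := map_add g, map_smul' := hcomm } s
  have : g = r.1 := by
    refine LinearMap.ext_on hs' fun m hm => hr m hm
  rw [this]
  exact r.2

variable {X : NAlg.{u} k} {S : Type u} [CommRing S] [Algebra k S]

theorem baseChange_mulLeft (x : X) (v : S ⊗[k] X) :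
    (LinearMap.mulLeft k x).baseChange S v = (1 ⊗ₜ x) * v := by
  induction v with
  | zero => simp
  | add v w hv hw => rw [map_add, hv, hw, mul_add]
  | tmul s y => simp [Algebra.TensorProduct.tmul_mul_tmul]

theorem baseChange_mulRight (x : X) (v : S ⊗[k] X) :
    (LinearMap.mulRight k x).baseChange S v = v * (1 ⊗ₜ x) := by
  induction v with
  | zero => simp
  | add v w hv hw => rw [map_add, hv, hw, add_mul]
  | tmul s y => simp [Algebra.TensorProduct.tmul_mul_tmul]

/-- A relation on a scalar extension of a finite dimensional central simple algebra that is stable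
under the multiplication operators is stable under all linear endomorphisms. -/
theorem baseChange_mem_of_mul_mem [Module.Finite k X] (hc : IsCentralAlg k X)
    (hs : IsSimpleAlg k X) (N : Submodule S ((S ⊗[k] X) × (S ⊗[k] X)))
    (hl : ∀ (x : X), ∀ p ∈ N, ((1 ⊗ₜ x) * p.1, (1 ⊗ₜ x) * p.2) ∈ N)
    (hr : ∀ (x : X), ∀ p ∈ N, (p.1 * (1 ⊗ₜ x), p.2 * (1 ⊗ₜ x)) ∈ N)
    (g : Module.End k X) : ∀ p ∈ N, (g.baseChange S p.1, g.baseChange S p.2) ∈ N := by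
  have hg : g ∈ Algebra.adjoin k (mulOperators k X) := by
    rw [adjoin_mulOperators_eq_top X hc hs]; trivial
  induction hg using Algebra.adjoin_induction with
  | mem g hg =>
    rcases hg with ⟨x, rfl⟩ | ⟨x, rfl⟩
    · simpa only [baseChange_mulLeft] using hl x
    · simpa only [baseChange_mulRight] using hr x
  | algebraMap c =>
    intro p hp
    have h (v : S ⊗[k] X) : (algebraMap k (Module.End k X) c).baseChange S v =
        algebraMap k S c • v := by
      rw [Algebra.algebraMap_eq_smul_one, LinearMap.baseChange_smul, algebraMap_smul,
        Module.End.one_eq_id, LinearMap.baseChange_id]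
      rfl
    rw [h, h]
    exact N.smul_mem (algebraMap k S c) hp
  | add f g _ _ hf hg =>
    intro p hp
    rw [LinearMap.baseChange_add]
    exact N.add_mem (hf p hp) (hg p hp)
  | mul f g _ _ hf hg =>
    intro p hp
    rw [LinearMap.baseChange_mul]
    exact hf _ (hg p hp)

/-- The rank one endomorphism `y ↦ f y • x`, after extension of scalars. -/
theorem baseChange_smulRight (f : X →ₗ[k] k) (x : X) (v : S ⊗[k] X) :
    (f.smulRight x).baseChange S v =
      (TensorProduct.AlgebraTensorModule.rid k S S (f.baseChange S v)) ⊗ₜ x := by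
  induction v with
  | zero => simp
  | add v w hv hw => simp only [map_add, hv, hw, TensorProduct.add_tmul]
  | tmul s y => simp [TensorProduct.tmul_smul, TensorProduct.smul_tmul']

/-- The coordinate functionals of a `k`-basis of `X` become, after base change, the coordinates of
`S ⊗ X` over `S`. -/
theorem exists_baseChange_ne_zero {v : S ⊗[k] X} (hv : v ≠ 0) :
    ∃ f : X →ₗ[k] k, TensorProduct.AlgebraTensorModule.rid k S S (f.baseChange S v) ≠ 0 := by
  by_contra! h
  apply hv
  let b := Module.Free.chooseBasis k X
  apply (Algebra.TensorProduct.basis S b).repr.injective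
  rw [map_zero]
  ext i
  rw [Finsupp.zero_apply, ← h (b.coord i)]
  clear h hv
  induction v with
  | zero => simp
  | add v w hv hw => simp only [map_add, Finsupp.add_apply, hv, hw]
  | tmul s y => simp [Algebra.TensorProduct.basis_repr_tmul, Algebra.smul_def, mul_comm]

theorem exists_dual_eq_one {x : X} (hx : x ≠ 0) : ∃ f : X →ₗ[k] k, f x = 1 := by
  obtain ⟨f, -, hf⟩ := LinearMap.exists_extend_of_notMem (p := (⊥ : Submodule k X)) (v := x) 0
    (by simpa using hx) (1 : k)
  exact ⟨f, hf⟩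

theorem tmul_ne_zero {s : S} {x : X} (hs : s ≠ 0) (hx : x ≠ 0) : s ⊗ₜ[k] x ≠ 0 := by
  intro h
  obtain ⟨f, hf⟩ := exists_dual_eq_one hx
  have := congrArg (fun v => TensorProduct.AlgebraTensorModule.rid k S S (f.baseChange S v)) h
  simp [hf] at this
  exact hs this

/-- A nonzero submodule of `S ⊗ X` closed under multiplication contains `s ⊗ X` for
some `s ≠ 0`. -/
theorem exists_forall_tmul_mem [Module.Finite k X] (hc : IsCentralAlg k X)
    (hs : IsSimpleAlg k X) (N : Submodule S (S ⊗[k] X)) (hN : N ≠ ⊥)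
    (hl : ∀ (x : X), ∀ v ∈ N, (1 ⊗ₜ x) * v ∈ N) (hr : ∀ (x : X), ∀ v ∈ N, v * (1 ⊗ₜ x) ∈ N) :
    ∃ s : S, s ≠ 0 ∧ ∀ x : X, s ⊗ₜ[k] x ∈ N := by
  obtain ⟨v, hv, hv0⟩ := N.ne_bot_iff.1 hN
  obtain ⟨f, hf⟩ := exists_baseChange_ne_zero hv0
  refine ⟨_, hf, fun x => ?_⟩
  -- A submodule is treated as a relation with trivial second coordinate. A rank one operator then
  -- moves `v` to `s ⊗ x`, with `s` the nonzero value of `f` on `v`.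
  have := baseChange_mem_of_mul_mem hc hs (N.prod ⊥)
    (fun x p hp => ⟨hl x _ hp.1, by simp [(Submodule.mem_bot S).1 hp.2]⟩)
    (fun x p hp => ⟨hr x _ hp.1, by simp [(Submodule.mem_bot S).1 hp.2]⟩)
    (f.smulRight x) (v, 0) ⟨hv, by simp⟩
  rw [← baseChange_smulRight]
  exact this.1

variable {A : Type u} [NonUnitalNonAssocRing A] [Module k A] [IsScalarTower k A A]
  [SMulCommClass k A A]

/-- A multiplicative embedding of `A` into `S ⊗ X` whose image spans over `S`. -/
structure IsSpanningEmbedding (ι : A →ₗ[k] S ⊗[k] X) : Prop where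
  map_mul : ∀ a b, ι (a * b) = ι a * ι b
  injective : Function.Injective ι
  span_range : Submodule.span S (Set.range ι) = ⊤

theorem IsSpanningEmbedding.span_induction {ι : A →ₗ[k] S ⊗[k] X} (hι : IsSpanningEmbedding ι)
    {p : S ⊗[k] X → Prop} (h0 : p 0) (hadd : ∀ v w, p v → p w → p (v + w))
    (hsmul : ∀ (s : S) v, p v → p (s • v)) (h : ∀ a, p (ι a)) (v : S ⊗[k] X) : p v := by
  have hv : v ∈ Submodule.span S (Set.range ι) := by rw [hι.span_range]; trivial
  induction hv using Submodule.span_induction with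
  | mem v hv => obtain ⟨a, rfl⟩ := hv; exact h a
  | zero => exact h0
  | add v w _ _ hv hw => exact hadd v w hv hw
  | smul s v _ hv => exact hsmul s v hv

theorem eq_zero_of_mul_eq_zero {ι : A →ₗ[k] S ⊗[k] X} (hι : IsSpanningEmbedding ι) (v : S ⊗[k] X)
    (h : ∀ a, v * ι a = 0) (w : S ⊗[k] X) : v * w = 0 := by
  induction w using hι.span_induction with
  | h0 => simp
  | hadd v w hv hw => rw [mul_add, hv, hw, add_zero]
  | hsmul s w hw => rw [mul_smul_comm, hw, smul_zero]
  | h a => exact h a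

/-- The elements of the centroid act as multiplication by scalars. -/
theorem IsSpanningEmbedding.exists_smul_eq [Module.Finite k X] (hc : IsCentralAlg k X)
    (hs : IsSimpleAlg k X) {ι : A →ₗ[k] S ⊗[k] X} (hι : IsSpanningEmbedding ι)
    (χ : centroid k A) : ∃ s : S, ∀ a, ι (χ.1 a) = s • ι a := by
  obtain ⟨x, y, hxy⟩ := hs.1
  -- The `S`-linear span of the graph of `χ`. It is shown to be the graph of a function on all of `S
  -- ⊗ X`, and then of multiplication by a scalar.
  let N : Submodule S ((S ⊗[k] X) × (S ⊗[k] X)) :=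
    Submodule.span S (Set.range fun a => (ι a, ι (χ.1 a)))
  have hN : ∀ a, (ι a, ι (χ.1 a)) ∈ N := fun a => Submodule.subset_span ⟨a, rfl⟩
  have hl (w : S ⊗[k] X) : ∀ p ∈ N, (w * p.1, w * p.2) ∈ N := by
    intro p hp
    induction hp using Submodule.span_induction with
    | zero => simp; exact N.zero_mem
    | add p q _ _ hp hq => simpa [mul_add] using N.add_mem hp hq
    | smul s p _ hp => simpa [mul_smul_comm] using N.smul_mem s hp
    | mem p hp =>
      obtain ⟨a, rfl⟩ := hp
      induction w using hι.span_induction with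
      | h0 => simp; exact N.zero_mem
      | hadd v w hv hw => simpa [add_mul] using N.add_mem hv hw
      | hsmul s v hv => simpa [smul_mul_assoc] using N.smul_mem s hv
      | h b => simpa [hι.map_mul, (χ.2 b a).2] using hN (b * a)
  have hr (w : S ⊗[k] X) : ∀ p ∈ N, (p.1 * w, p.2 * w) ∈ N := by
    intro p hp
    induction hp using Submodule.span_induction with
    | zero => simp; exact N.zero_mem
    | add p q _ _ hp hq => simpa [add_mul] using N.add_mem hp hq
    | smul s p _ hp => simpa [smul_mul_assoc] using N.smul_mem s hp
    | mem p hp =>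
      obtain ⟨a, rfl⟩ := hp
      induction w using hι.span_induction with
      | h0 => simp; exact N.zero_mem
      | hadd v w hv hw => simpa [mul_add] using N.add_mem hv hw
      | hsmul s v hv => simpa [mul_smul_comm] using N.smul_mem s hv
      | h b => simpa [hι.map_mul, (χ.2 a b).1] using hN (a * b)
  have hmul : ∀ p ∈ N, ∀ a, p.2 * ι a = p.1 * ι (χ.1 a) := by
    intro p hp a
    induction hp using Submodule.span_induction with
    | zero => simp
    | add p q _ _ hp hq => simp [add_mul, hp, hq]
    | smul s p _ hp => simp [smul_mul_assoc, hp]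
    | mem p hp =>
      obtain ⟨b, rfl⟩ := hp
      rw [← hι.map_mul, ← hι.map_mul, ← (χ.2 b a).1, (χ.2 b a).2]
  -- Single-valuedness: a nonzero fibre over `0` would contain `s ⊗ X` with `s ≠ 0`. By `hmul` such
  -- elements annihilate `S ⊗ X`, contradicting `x * y ≠ 0`.
  have hzero (w : S ⊗[k] X) (hw : (0, w) ∈ N) : w = 0 := by
    by_contra hw0
    obtain ⟨s, hs0, hs'⟩ := exists_forall_tmul_mem hc hs (N.comap (LinearMap.inr S _ _))
      (Submodule.ne_bot_iff _ |>.2 ⟨w, hw, hw0⟩)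
      (fun x v hv => by simpa using hl (1 ⊗ₜ x) _ hv) (fun x v hv => by simpa using hr (1 ⊗ₜ x) _ hv)
    have h1 := eq_zero_of_mul_eq_zero hι (s ⊗ₜ x) (fun a => by simpa using hmul _ (hs' x) a)
      (1 ⊗ₜ y)
    rw [Algebra.TensorProduct.tmul_mul_tmul, mul_one] at h1
    exact tmul_ne_zero hs0 hxy h1
  have hx : x ≠ 0 := by rintro rfl; simp at hxy
  obtain ⟨f, hf⟩ := exists_dual_eq_one hx
  have hex (v : S ⊗[k] X) : ∃ w, (v, w) ∈ N := by
    induction v using hι.span_induction with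
    | h0 => exact ⟨0, N.zero_mem⟩
    | hadd v w hv hw =>
      obtain ⟨v', hv⟩ := hv
      obtain ⟨w', hw⟩ := hw
      exact ⟨_, N.add_mem hv hw⟩
    | hsmul s v hv =>
      obtain ⟨v', hv⟩ := hv
      exact ⟨_, N.smul_mem s hv⟩
    | h a => exact ⟨_, hN a⟩
  obtain ⟨w, hw⟩ := hex (1 ⊗ₜ x)
  refine ⟨TensorProduct.AlgebraTensorModule.rid k S S (f.baseChange S w), fun a => ?_⟩
  set s := TensorProduct.AlgebraTensorModule.rid k S S (f.baseChange S w) with hsdef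
  have h1 (v : S ⊗[k] X) : (v, s • v) ∈ N := by
    induction v with
    | zero => simp; exact N.zero_mem
    | add v w hv hw => simpa using N.add_mem hv hw
    | tmul t z =>
      -- The rank one operator sending `x` to `z` turns `(1 ⊗ x, w)` into `(1 ⊗ z, s ⊗ z)`, with the
      -- same `s` for every `z`.
      have := baseChange_mem_of_mul_mem hc hs N (fun x => hl (1 ⊗ₜ x)) (fun x => hr (1 ⊗ₜ x))
        (f.smulRight z) _ hw
      rw [baseChange_smulRight, baseChange_smulRight] at this
      simpa [hf, TensorProduct.smul_tmul', mul_comm, ← hsdef] using N.smul_mem t this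
  have := N.sub_mem (hN a) (h1 (ι a))
  rw [Prod.mk_sub_mk, sub_self] at this
  exact sub_eq_zero.1 (hzero _ this)

/-- An algebra with a spanning embedding into `S ⊗ X`, for a domain `S`, is prime. -/
theorem IsSpanningEmbedding.isPrimeAlg [IsDomain S] [Module.Finite k X] (hc : IsCentralAlg k X)
    (hs : IsSimpleAlg k X) {ι : A →ₗ[k] S ⊗[k] X} (hι : IsSpanningEmbedding ι) :
    IsPrimeAlg k A := by
  intro I J hI hJ hIJ
  by_contra! hne
  -- The `S`-span of a nonzero ideal of `A` is a nonzero ideal of `S ⊗ X`. Two such spans contain `s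
  -- ⊗ X` and `t ⊗ X`, whose product is nonzero because `S` is a domain.
  have key (I : Submodule k A) (hI : IsIdeal k I) (hne : I ≠ ⊥) :
      ∃ s : S, s ≠ 0 ∧ ∀ x : X, s ⊗ₜ[k] x ∈ Submodule.span S (ι '' I) := by
    obtain ⟨a, ha, ha0⟩ := I.ne_bot_iff.1 hne
    have hmem (v : S ⊗[k] X) : ∀ w ∈ Submodule.span S (ι '' I),
        v * w ∈ Submodule.span S (ι '' I) ∧ w * v ∈ Submodule.span S (ι '' I) := by
      intro w hw
      induction hw using Submodule.span_induction with
      | zero => simp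
      | add w w' _ _ h h' =>
        rw [mul_add, add_mul]
        exact ⟨Submodule.add_mem _ h.1 h'.1, Submodule.add_mem _ h.2 h'.2⟩
      | smul s w _ h =>
        rw [mul_smul_comm, smul_mul_assoc]
        exact ⟨Submodule.smul_mem _ s h.1, Submodule.smul_mem _ s h.2⟩
      | mem w hw =>
        obtain ⟨b, hb, rfl⟩ := hw
        induction v using hι.span_induction with
        | h0 => simp
        | hadd v w h h' =>
          rw [mul_add, add_mul]
          exact ⟨Submodule.add_mem _ h.1 h'.1, Submodule.add_mem _ h.2 h'.2⟩
        | hsmul s v h =>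
          rw [mul_smul_comm, smul_mul_assoc]
          exact ⟨Submodule.smul_mem _ s h.1, Submodule.smul_mem _ s h.2⟩
        | h c =>
          rw [← hι.map_mul, ← hι.map_mul]
          exact ⟨Submodule.subset_span ⟨_, (hI b hb c).1, rfl⟩,
            Submodule.subset_span ⟨_, (hI b hb c).2, rfl⟩⟩
    refine exists_forall_tmul_mem hc hs _ (Submodule.ne_bot_iff _ |>.2
      ⟨ι a, Submodule.subset_span ⟨a, ha, rfl⟩, fun h => ha0 (hι.injective ?_)⟩)
      (fun x v hv => (hmem _ v hv).1) (fun x v hv => (hmem _ v hv).2)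
    rw [h, map_zero]
  obtain ⟨s, hs0, hsI⟩ := key I hI hne.1
  obtain ⟨t, ht0, htJ⟩ := key J hJ hne.2
  obtain ⟨x, y, hxy⟩ := hs.1
  have hzero : ∀ v ∈ Submodule.span S (ι '' I), ∀ w ∈ Submodule.span S (ι '' J), v * w = 0 := by
    intro v hv w hw
    induction hv using Submodule.span_induction with
    | zero => simp
    | add v v' _ _ h h' => rw [add_mul, h, h', add_zero]
    | smul s v _ h => rw [smul_mul_assoc, h, smul_zero]
    | mem v hv =>
      obtain ⟨a, ha, rfl⟩ := hv
      induction hw using Submodule.span_induction with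
      | zero => simp
      | add v v' _ _ h h' => rw [mul_add, h, h', add_zero]
      | smul s v _ h => rw [mul_smul_comm, h, smul_zero]
      | mem w hw =>
        obtain ⟨b, hb, rfl⟩ := hw
        rw [← hι.map_mul, hIJ a ha b hb, map_zero]
  have := hzero _ (hsI x) _ (htJ y)
  rw [Algebra.TensorProduct.tmul_mul_tmul] at this
  exact tmul_ne_zero (mul_ne_zero hs0 ht0) hxy this

end CentralSimple

/-! ### The centroid as a ring of scalars, and forms of `X`. -/

section Form

variable {k : Type u} [Field k] {X : NAlg.{u} k} {S : Type u} [CommRing S] [Algebra k S]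
  {A : Type u} [NonUnitalNonAssocRing A] [Module k A] [IsScalarTower k A A]
  [SMulCommClass k A A]

/-- The scalars of `S` that map the image of `ι` into itself. -/
def stabilizer (ι : A →ₗ[k] S ⊗[k] X) : Subalgebra k S where
  carrier := {s | ∀ a, ∃ b, s • ι a = ι b}
  mul_mem' := by
    intro s t hs ht a
    obtain ⟨b, hb⟩ := ht a
    obtain ⟨c, hc⟩ := hs b
    exact ⟨c, by rw [mul_smul, hb, hc]⟩
  add_mem' := by
    intro s t hs ht a
    obtain ⟨b, hb⟩ := hs a
    obtain ⟨c, hc⟩ := ht a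
    exact ⟨b + c, by rw [add_smul, hb, hc, map_add]⟩
  algebraMap_mem' := fun c a => ⟨c • a, by rw [algebraMap_smul, map_smul]⟩

/-- Equality spreads from the image of `ι` to `S ⊗ X` by spanning, and `S` acts faithfully there
since `X ≠ 0`. This uniqueness of scalars makes `centroidHom` a homomorphism. -/
theorem IsSpanningEmbedding.smul_left_injective (hs : IsSimpleAlg k X) {ι : A →ₗ[k] S ⊗[k] X}
    (hι : IsSpanningEmbedding ι) {s t : S} (h : ∀ a, s • ι a = t • ι a) : s = t := by
  obtain ⟨x, y, hxy⟩ := hs.1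
  have hx : x ≠ 0 := by rintro rfl; simp at hxy
  have key (v : S ⊗[k] X) : s • v = t • v := by
    induction v using hι.span_induction with
    | h0 => simp
    | hadd v w hv hw => rw [smul_add, smul_add, hv, hw]
    | hsmul r v hv => rw [smul_comm, hv, smul_comm]
    | h a => exact h a
  by_contra hst
  apply tmul_ne_zero (k := k) (sub_ne_zero.2 hst) hx
  have := key (1 ⊗ₜ x)
  rw [TensorProduct.smul_tmul', TensorProduct.smul_tmul', smul_eq_mul, smul_eq_mul, mul_one,
    mul_one] at this
  rw [TensorProduct.sub_tmul, this, sub_self]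

/-- The action of the centroid on `A`, read off as scalars of `S`. -/
noncomputable def centroidHom [Module.Finite k X] (hc : IsCentralAlg k X) (hs : IsSimpleAlg k X)
    {ι : A →ₗ[k] S ⊗[k] X} (hι : IsSpanningEmbedding ι) : centroid k A →ₐ[k] S where
  toFun χ := (hι.exists_smul_eq hc hs χ).choose
  map_one' := hι.smul_left_injective hs fun a => by
    rw [← (hι.exists_smul_eq hc hs 1).choose_spec, one_smul]; rfl
  map_zero' := hι.smul_left_injective hs fun a => by
    rw [← (hι.exists_smul_eq hc hs 0).choose_spec, zero_smul, ← map_zero ι]; rfl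
  map_mul' χ ψ := hι.smul_left_injective hs fun a => by
    rw [← (hι.exists_smul_eq hc hs _).choose_spec, mul_smul,
      ← (hι.exists_smul_eq hc hs ψ).choose_spec, ← (hι.exists_smul_eq hc hs χ).choose_spec]
    rfl
  map_add' χ ψ := hι.smul_left_injective hs fun a => by
    rw [← (hι.exists_smul_eq hc hs _).choose_spec, add_smul,
      ← (hι.exists_smul_eq hc hs ψ).choose_spec, ← (hι.exists_smul_eq hc hs χ).choose_spec,
      ← map_add]
    rfl
  commutes' c := hι.smul_left_injective hs fun a => by
    rw [← (hι.exists_smul_eq hc hs _).choose_spec, algebraMap_smul, ← map_smul]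
    rfl

section Centroid

variable [Module.Finite k X] (hc : IsCentralAlg k X) (hs : IsSimpleAlg k X)
  {ι : A →ₗ[k] S ⊗[k] X} (hι : IsSpanningEmbedding ι)

theorem map_centroid_apply (χ : centroid k A) (a : A) :
    ι (χ.1 a) = centroidHom hc hs hι χ • ι a :=
  (hι.exists_smul_eq hc hs χ).choose_spec a

theorem centroidHom_injective : Function.Injective (centroidHom hc hs hι) := by
  intro χ ψ h
  apply Subtype.ext
  ext a
  apply hι.injective
  rw [map_centroid_apply hc hs hι, map_centroid_apply hc hs hι, h]

/-- Multiplication by `s` can be pulled back along the injective `ι`, and it commutes with products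
in `S ⊗ X`. This is surjectivity of the centroid onto the stabilizer. -/
theorem exists_centroid_of_mem_stabilizer {s : S} (h : s ∈ stabilizer ι) :
    ∃ χ : centroid k A, centroidHom hc hs hι χ = s := by
  let e := LinearEquiv.ofInjective ι hι.injective
  let χ : A →ₗ[k] A := e.symm.toLinearMap ∘ₗ
    (LinearMap.codRestrict ι.range ((Algebra.lsmul k k (S ⊗[k] X) s) ∘ₗ ι) fun a => by
      obtain ⟨b, hb⟩ := h a
      exact ⟨b, hb.symm⟩)
  have hχ (a : A) : ι (χ a) = s • ι a := by
    have : (e (χ a)).1 = s • ι a := by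
      simp only [χ, LinearMap.comp_apply, LinearEquiv.coe_coe, LinearEquiv.apply_symm_apply]
      rfl
    exact this
  refine ⟨⟨χ, fun a b => ⟨hι.injective ?_, hι.injective ?_⟩⟩,
    hι.smul_left_injective hs fun a => ?_⟩
  · rw [hχ, hι.map_mul, hι.map_mul, hχ, smul_mul_assoc]
  · rw [hχ, hι.map_mul, hι.map_mul, hχ, mul_smul_comm]
  · rw [← map_centroid_apply, hχ]

theorem centroidHom_mem_stabilizer (χ : centroid k A) :
    centroidHom hc hs hι χ ∈ stabilizer ι :=
  fun a => ⟨χ.1 a, (map_centroid_apply hc hs hι χ a).symm⟩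

end Centroid

/-! ### Gradings and homogeneous components of the centroid. -/

section Graded

variable {m : ℕ} (G : Grading k A m)

/-- The projection of a graded algebra onto a homogeneous component. -/
noncomputable def Grading.proj (i : ZMod m) : A →ₗ[k] A :=
  (G.piece i).subtype ∘ₗ DirectSum.component k (ZMod m) (fun i => G.piece i) i ∘ₗ
    (LinearEquiv.ofBijective (DirectSum.coeLinearMap G.piece) G.isInternal).symm.toLinearMap

theorem Grading.proj_mem (i : ZMod m) (a : A) : G.proj i a ∈ G.piece i := Subtype.prop _

theorem Grading.proj_of_mem {i : ZMod m} {a : A} (ha : a ∈ G.piece i) : G.proj i a = a := by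
  have h : (LinearEquiv.ofBijective (DirectSum.coeLinearMap G.piece) G.isInternal).symm a =
      DirectSum.lof k (ZMod m) (fun i => G.piece i) i ⟨a, ha⟩ := by
    rw [LinearEquiv.symm_apply_eq]
    exact (DirectSum.coeLinearMap_lof G.piece i ⟨a, ha⟩).symm
  simp only [Grading.proj, LinearMap.comp_apply, LinearEquiv.coe_coe, h]
  rw [DirectSum.component.lof_self]
  rfl

theorem Grading.proj_of_mem_of_ne {i j : ZMod m} {a : A} (ha : a ∈ G.piece i) (hij : i ≠ j) :
    G.proj j a = 0 := by
  have h : (LinearEquiv.ofBijective (DirectSum.coeLinearMap G.piece) G.isInternal).symm a =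
      DirectSum.lof k (ZMod m) (fun i => G.piece i) i ⟨a, ha⟩ := by
    rw [LinearEquiv.symm_apply_eq]
    exact (DirectSum.coeLinearMap_lof G.piece i ⟨a, ha⟩).symm
  simp only [Grading.proj, LinearMap.comp_apply, LinearEquiv.coe_coe, h]
  rw [DirectSum.component.of, dif_neg hij]
  rfl

theorem Grading.induction {p : A → Prop} (hadd : ∀ a b, p a → p b → p (a + b))
    (h : ∀ i, ∀ a ∈ G.piece i, p a) (a : A) : p a := by
  have ha : a ∈ ⨆ i, G.piece i := by
    rw [G.isInternal.submodule_iSup_eq_top]; trivial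
  induction ha using Submodule.iSup_induction' with
  | mem i a ha => exact h i a ha
  | zero => exact h 0 0 (Submodule.zero_mem _)
  | add a b _ _ ha hb => exact hadd a b ha hb

variable [NeZero m]

theorem Grading.sum_proj (a : A) : ∑ i, G.proj i a = a := by
  induction a using G.induction with
  | hadd a b ha hb => simp only [map_add, Finset.sum_add_distrib, ha, hb]
  | h i a ha =>
    rw [Finset.sum_eq_single i (fun j _ hj => G.proj_of_mem_of_ne ha hj.symm) (by simp),
      G.proj_of_mem ha]

theorem Grading.proj_mul_of_mem_right {i j : ZMod m} (a : A) {b : A} (hb : b ∈ G.piece j) :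
    G.proj (i + j) (a * b) = G.proj i a * b := by
  induction a using G.induction with
  | hadd a b ha hb => simp only [map_add, add_mul, ha, hb]
  | h l a ha =>
    by_cases hl : l = i
    · subst hl
      rw [G.proj_of_mem (G.mul_mem ha hb), G.proj_of_mem ha]
    · rw [G.proj_of_mem_of_ne (G.mul_mem ha hb) (by simpa using hl), G.proj_of_mem_of_ne ha hl,
        zero_mul]

theorem Grading.proj_mul_of_mem_left {i j : ZMod m} {a : A} (ha : a ∈ G.piece i) (b : A) :
    G.proj (i + j) (a * b) = a * G.proj j b := by
  induction b using G.induction with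
  | hadd b c hb hc => simp only [map_add, mul_add, hb, hc]
  | h l b hb =>
    by_cases hl : l = j
    · subst hl
      rw [G.proj_of_mem (G.mul_mem ha hb), G.proj_of_mem hb]
    · rw [G.proj_of_mem_of_ne (G.mul_mem ha hb) (by simpa using hl), G.proj_of_mem_of_ne hb hl,
        mul_zero]

/-- The homogeneous component of degree `h` of an endomorphism of a graded algebra. -/
noncomputable def Grading.endComponent (h : ZMod m) (χ : Module.End k A) : Module.End k A :=
  ∑ i, G.proj (i + h) ∘ₗ χ ∘ₗ G.proj i

theorem Grading.endComponent_apply (h : ZMod m) (χ : Module.End k A) {i : ZMod m} {a : A}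
    (ha : a ∈ G.piece i) : G.endComponent h χ a = G.proj (i + h) (χ a) := by
  rw [Grading.endComponent, LinearMap.sum_apply, Finset.sum_eq_single i]
  · simp [G.proj_of_mem ha]
  · intro j _ hj
    simp [G.proj_of_mem_of_ne ha hj.symm]
  · simp

theorem Grading.sum_endComponent (χ : Module.End k A) : ∑ h, G.endComponent h χ = χ := by
  ext a
  rw [LinearMap.sum_apply]
  induction a using G.induction with
  | hadd a b ha hb => simp only [map_add, Finset.sum_add_distrib, ha, hb]
  | h i a ha =>
    simp only [G.endComponent_apply _ χ ha]
    exact (Equiv.sum_comp (Equiv.addLeft i) fun j => G.proj j (χ a)).trans (G.sum_proj _)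

/-- For `a`, `b` homogeneous of degrees `i`, `j`, take the components of degree `i + j + h` in `χ (a
* b) = χ a * b = a * χ b`. -/
theorem Grading.endComponent_mem_centroid (h : ZMod m) (χ : centroid k A) :
    G.endComponent h χ.1 ∈ centroid k A := by
  intro a b
  induction a using G.induction with
  | hadd a a' ha ha' =>
    simp only [add_mul, map_add]
    exact ⟨by rw [ha.1, ha'.1], by rw [ha.2, ha'.2]⟩
  | h i a ha =>
    induction b using G.induction with
    | hadd b b' hb hb' =>
      simp only [mul_add, map_add]
      exact ⟨by rw [hb.1, hb'.1], by rw [hb.2, hb'.2]⟩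
    | h j b hb =>
      rw [G.endComponent_apply _ _ (G.mul_mem ha hb), G.endComponent_apply _ _ ha,
        G.endComponent_apply _ _ hb, ← G.proj_mul_of_mem_right _ hb, ← G.proj_mul_of_mem_left ha,
        ← (χ.2 a b).1, ← (χ.2 a b).2]
      exact ⟨by rw [add_right_comm], by rw [add_assoc]⟩

/-- The scalars that raise degrees by `h`. -/
def homogStabilizer (ι : A →ₗ[k] S ⊗[k] X) (h : ZMod m) : Set S :=
  {s | ∀ i, ∀ a ∈ G.piece i, ∃ b ∈ G.piece (i + h), s • ι a = ι b}

/-- The stabilizer is graded by any grading of `A`. -/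
theorem exists_sum_homogStabilizer [Module.Finite k X] (hc : IsCentralAlg k X)
    (hs : IsSimpleAlg k X) {ι : A →ₗ[k] S ⊗[k] X} (hι : IsSpanningEmbedding ι) {s : S}
    (h : s ∈ stabilizer ι) :
    ∃ c : ZMod m → S, (∀ h, c h ∈ homogStabilizer G ι h) ∧ s = ∑ h, c h := by
  obtain ⟨χ, rfl⟩ := exists_centroid_of_mem_stabilizer hc hs hι h
  refine ⟨fun h => centroidHom hc hs hι ⟨_, G.endComponent_mem_centroid h χ⟩,
    fun h i a ha => ⟨G.endComponent h χ.1 a, ?_, ?_⟩, ?_⟩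
  · rw [G.endComponent_apply _ _ ha]
    exact G.proj_mem _ _
  · exact (map_centroid_apply hc hs hι _ a).symm
  · rw [← map_sum]
    congr 1
    apply Subtype.ext
    rw [AddSubmonoidClass.coe_finsetSum]
    exact (G.sum_endComponent χ.1).symm

theorem homogStabilizer_subset (ι : A →ₗ[k] S ⊗[k] X) (h : ZMod m) {s : S}
    (hs : s ∈ homogStabilizer G ι h) : s ∈ stabilizer ι := by
  intro a
  induction a using G.induction with
  | hadd a b ha hb =>
    obtain ⟨a', ha⟩ := ha
    obtain ⟨b', hb⟩ := hb
    exact ⟨a' + b', by rw [map_add, smul_add, ha, hb, map_add]⟩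
  | h i a ha =>
    obtain ⟨b, -, hb⟩ := hs i a ha
    exact ⟨b, hb⟩

end Graded

/-- The span of the image of a set over the stabilizer. -/
def stabilizerSpan (ι : A →ₗ[k] S ⊗[k] X) (F : Set A) : Submodule (stabilizer ι) (S ⊗[k] X) :=
  Submodule.span (stabilizer ι) (ι '' F)

theorem smul_mem_stabilizerSpan {ι : A →ₗ[k] S ⊗[k] X} {F : Set A} {s : S}
    (hs : s ∈ stabilizer ι) {v : S ⊗[k] X} (hv : v ∈ stabilizerSpan ι F) :
    s • v ∈ stabilizerSpan ι F :=
  (stabilizerSpan ι F).smul_mem (⟨s, hs⟩ : stabilizer ι) hv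

theorem mem_stabilizerSpan (ι : A →ₗ[k] S ⊗[k] X) {F : Set A} {a : A} (ha : a ∈ F) :
    ι a ∈ stabilizerSpan ι F :=
  Submodule.subset_span ⟨a, ha, rfl⟩

/-- An embedding of `A` into `S ⊗ X` that identifies `S ⊗ X` with the scalar extension of `A` from
the stabilizer to `S`, where `S` is integral over the stabilizer and `A` is finitely generated over
the stabilizer. -/
structure IsForm (ι : A →ₗ[k] S ⊗[k] X) : Prop extends IsSpanningEmbedding ι where
  exists_lift : ∀ (P : Type u) [AddCommGroup P] [Module k P] (β : S →ₗ[k] A →ₗ[k] P),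
    (∀ s, ∀ r ∈ stabilizer ι, ∀ a b, r • ι a = ι b → β (s * r) a = β s b) →
    ∃ γ : S ⊗[k] X →ₗ[k] P, ∀ s a, γ (s • ι a) = β s a
  isIntegral : ∀ s : S, IsIntegral (stabilizer ι) s
  fg : ∃ F : Set A, F.Finite ∧ ∀ a, ι a ∈ stabilizerSpan ι F

/-- A finite dimensional algebra is a form of itself. -/
theorem isForm_lid_symm (X : NAlg.{u} k) [Module.Finite k X] :
    IsForm (X := X) (S := k) (TensorProduct.lid k X).symm.toLinearMap where
  map_mul a b := by simp [Algebra.TensorProduct.tmul_mul_tmul]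
  injective := (TensorProduct.lid k X).symm.injective
  span_range := by
    rw [eq_top_iff]
    intro v _
    exact Submodule.subset_span ((TensorProduct.lid k X).symm.surjective v)
  exists_lift P _ _ β _ := ⟨β 1 ∘ₗ (TensorProduct.lid k X).toLinearMap, fun s a => by
    simpa using (congrArg (fun f => f a) (β.map_smul s 1)).symm⟩
  isIntegral s := isIntegral_algebraMap (x := (⟨s, Subalgebra.algebraMap_mem _ s⟩ :
    stabilizer (X := X) (S := k) (TensorProduct.lid k X).symm.toLinearMap))
  fg := by
    obtain ⟨F, hF⟩ := Module.Finite.fg_top (R := k) (M := X)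
    refine ⟨F, F.finite_toSet, fun a => ?_⟩
    have ha : a ∈ Submodule.span k (F : Set X) := by rw [hF]; trivial
    apply Submodule.span_le_restrictScalars k
    rw [Submodule.span_image]
    exact ⟨a, ha, rfl⟩

end Form

/-! ### Laurent polynomial extensions and the embedding of a loop algebra. -/

section Laurent

open LaurentPolynomial

variable {k : Type u} [Field k] {X : NAlg.{u} k} {S : Type u} [CommRing S] [Algebra k S]

/-- Multiplication by `z ^ q`, from `S ⊗ X` to `S[z, z⁻¹] ⊗ X`. -/
noncomputable def laurentMono (q : ℤ) : S ⊗[k] X →ₗ[k] LaurentPolynomial S ⊗[k] X :=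
  LinearMap.rTensor X ((AddMonoidAlgebra.coeffLinearEquiv k).symm.toLinearMap ∘ₗ
    Finsupp.lsingle (M := S) q)

theorem laurentMono_tmul (q : ℤ) (s : S) (x : X) :
    laurentMono q (s ⊗ₜ[k] x) = (C s * T q) ⊗ₜ[k] x := by
  rw [← single_eq_C_mul_T]
  rfl

theorem laurentMono_mul (q r : ℤ) (v w : S ⊗[k] X) :
    laurentMono (q + r) (v * w) = laurentMono q v * laurentMono r w := by
  induction v with
  | zero => simp
  | add v v' hv hv' => rw [add_mul, map_add, hv, hv', map_add, add_mul]
  | tmul s x =>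
    induction w with
    | zero => simp
    | add v v' hv hv' => rw [mul_add, map_add, hv, hv', map_add, mul_add]
    | tmul t y =>
      simp only [Algebra.TensorProduct.tmul_mul_tmul, laurentMono_tmul, map_mul, T_add]
      congr 1
      ring

theorem C_mul_T_smul_laurentMono (s : S) (n q : ℤ) (v : S ⊗[k] X) :
    (C s * T n : LaurentPolynomial S) • laurentMono q v = laurentMono (n + q) (s • v) := by
  induction v with
  | zero => simp
  | add v v' hv hv' => rw [smul_add, map_add, smul_add, hv, hv', map_add]
  | tmul t x =>
    simp only [TensorProduct.smul_tmul', laurentMono_tmul, smul_eq_mul, map_mul, T_add]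
    congr 1
    ring

theorem T_smul_laurentMono (n q : ℤ) (v : S ⊗[k] X) :
    (T n : LaurentPolynomial S) • laurentMono q v = laurentMono (n + q) v := by
  simpa using C_mul_T_smul_laurentMono 1 n q v

theorem C_smul_laurentMono (s : S) (q : ℤ) (v : S ⊗[k] X) :
    (C s : LaurentPolynomial S) • laurentMono q v = laurentMono q (s • v) := by
  simpa using C_mul_T_smul_laurentMono s 0 q v

theorem laurent_span (v : LaurentPolynomial S ⊗[k] X) :
    v ∈ Submodule.span (LaurentPolynomial S)
      (Set.range (laurentMono (k := k) (X := X) (S := S) 0)) := by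
  induction v with
  | zero => exact Submodule.zero_mem _
  | add v w hv hw => exact Submodule.add_mem _ hv hw
  | tmul p x =>
    have : p ⊗ₜ[k] x = p • laurentMono (S := S) 0 (1 ⊗ₜ x) := by
      rw [laurentMono_tmul, TensorProduct.smul_tmul']
      simp
    rw [this]
    exact Submodule.smul_mem _ _ (Submodule.subset_span ⟨_, rfl⟩)

/-- A family of linear maps on the homogeneous components of `S[z, z⁻¹] ⊗ X` defines a linear map
on `S[z, z⁻¹] ⊗ X`. -/
theorem exists_laurent_lift {P : Type u} [AddCommGroup P] [Module k P]
    (γ : ℤ → S ⊗[k] X →ₗ[k] P) :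
    ∃ Γ : LaurentPolynomial S ⊗[k] X →ₗ[k] P, ∀ q v, Γ (laurentMono q v) = γ q v := by
  refine ⟨TensorProduct.lift ((Finsupp.lsum k fun q => TensorProduct.curry (γ q)) ∘ₗ
    (AddMonoidAlgebra.coeffLinearEquiv k).toLinearMap), fun q v => ?_⟩
  induction v with
  | zero => simp
  | add v w hv hw => rw [map_add, map_add, hv, hw, map_add]
  | tmul s x =>
    rw [laurentMono_tmul, ← single_eq_C_mul_T, TensorProduct.lift.tmul, LinearMap.comp_apply]
    change (Finsupp.lsum k fun q => TensorProduct.curry (γ q)) (Finsupp.single q s) x = _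
    rw [Finsupp.lsum_single]
    rfl

variable {A : Type u} [NonUnitalNonAssocRing A] [Module k A] [IsScalarTower k A A]
  [SMulCommClass k A A] {m : ℕ} (G : Grading k A m)

/-- The coefficients of an element of `A ⊗ k[z, z⁻¹]`. -/
noncomputable def laurentCoeff (k A : Type u) [Field k] [AddCommGroup A] [Module k A] :
    A ⊗[k] LaurentPolynomial k ≃ₗ[k] (ℤ →₀ A) :=
  (TensorProduct.congr (LinearEquiv.refl k A) (AddMonoidAlgebra.coeffLinearEquiv k)).trans
    (TensorProduct.finsuppScalarRight k k A ℤ)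

theorem laurentCoeff_tmul_T (a : A) (i : ℤ) :
    laurentCoeff k A (a ⊗ₜ T i) = Finsupp.single i a := by
  change TensorProduct.finsuppScalarRight k k A ℤ (a ⊗ₜ Finsupp.single i 1) = _
  rw [TensorProduct.finsuppScalarRight_apply_tmul]
  simp

/-- The element `a ⊗ z ^ i` of a loop algebra. -/
noncomputable def loopMk (i : ℤ) (a : A) (ha : a ∈ G.piece (i : ZMod m)) : loopSubalgebra G :=
  ⟨a ⊗ₜ T i, Submodule.subset_span ⟨i, a, ha, rfl⟩⟩

/-- Zero and scalar multiples need no separate cases, because the homogeneous components of `A` are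
subspaces. -/
theorem loop_induction {p : loopSubalgebra G → Prop} (hadd : ∀ v w, p v → p w → p (v + w))
    (h : ∀ i a ha, p (loopMk G i a ha)) (v : loopSubalgebra G) : p v := by
  obtain ⟨v, hv⟩ := v
  have hv' : v ∈ Submodule.span k {x | ∃ (i : ℤ) (a : A), a ∈ G.piece (i : ZMod m) ∧
      x = a ⊗ₜ[k] (T i : LaurentPolynomial k)} := hv
  suffices ∃ hv, p ⟨v, hv⟩ from this.2
  clear hv
  induction hv' using Submodule.closure_induction with
  | zero =>
    refine ⟨zero_mem _, ?_⟩
    convert h 0 0 (Submodule.zero_mem _)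
    exact (TensorProduct.zero_tmul _ _).symm
  | add v w _ _ hv hw => exact ⟨add_mem hv.1 hw.1, hadd _ _ hv.2 hw.2⟩
  | smul_mem c v hv =>
    obtain ⟨i, a, ha, rfl⟩ := hv
    exact ⟨_, h i (c • a) (Submodule.smul_mem _ c ha)⟩

/-- The embedding of a loop algebra into `S[z, z⁻¹] ⊗ X` defined by an embedding of the base
algebra into `S ⊗ X`. -/
noncomputable def loopEmbedding (ι : A →ₗ[k] S ⊗[k] X) :
    loopSubalgebra G →ₗ[k] LaurentPolynomial S ⊗[k] X :=
  (Finsupp.lsum k fun q => laurentMono q ∘ₗ ι) ∘ₗ (laurentCoeff k A).toLinearMap ∘ₗ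
    (loopSubalgebra G).toSubmodule.subtype

theorem loopEmbedding_loopMk (ι : A →ₗ[k] S ⊗[k] X) (i : ℤ) (a : A)
    (ha : a ∈ G.piece (i : ZMod m)) :
    loopEmbedding G ι (loopMk G i a ha) = laurentMono i (ι a) := by
  change (Finsupp.lsum k fun q => laurentMono q ∘ₗ ι) (laurentCoeff k A (a ⊗ₜ T i)) = _
  rw [laurentCoeff_tmul_T, Finsupp.lsum_single]
  rfl

theorem loopMk_mul (i j : ℤ) (a b : A) (ha : a ∈ G.piece (i : ZMod m))
    (hb : b ∈ G.piece (j : ZMod m)) :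
    loopMk G i a ha * loopMk G j b hb =
      loopMk G (i + j) (a * b) (by rw [Int.cast_add]; exact G.mul_mem ha hb) := by
  apply Subtype.ext
  change (a ⊗ₜ[k] (T i : LaurentPolynomial k)) * (b ⊗ₜ T j) = (a * b) ⊗ₜ T (i + j)
  rw [Algebra.TensorProduct.tmul_mul_tmul, T_add]

theorem loopEmbedding_mul {ι : A →ₗ[k] S ⊗[k] X} (hι : ∀ a b, ι (a * b) = ι a * ι b)
    (v w : loopSubalgebra G) :
    loopEmbedding G ι (v * w) = loopEmbedding G ι v * loopEmbedding G ι w := by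
  induction v using loop_induction with
  | hadd v v' hv hv' => rw [add_mul, map_add, hv, hv', map_add, add_mul]
  | h i a ha =>
    induction w using loop_induction with
    | hadd v v' hv hv' => rw [mul_add, map_add, hv, hv', map_add, mul_add]
    | h j b hb =>
      simp only [loopMk_mul, loopEmbedding_loopMk, hι, laurentMono_mul]

theorem loopEmbedding_injective {ι : A →ₗ[k] S ⊗[k] X} (hι : Function.Injective ι) :
    Function.Injective (loopEmbedding G ι) := by
  rw [injective_iff_map_eq_zero]
  intro v hv
  have h0 : laurentCoeff k A v.1 = 0 := by
    ext q
    apply hι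
    -- `Γ` extracts the coefficient of `z ^ q`.
    obtain ⟨Γ, hΓ⟩ := exists_laurent_lift (k := k) (X := X) (S := S)
      fun r => if r = q then LinearMap.id else 0
    have key (v : loopSubalgebra G) : Γ (loopEmbedding G ι v) = ι (laurentCoeff k A v.1 q) := by
      induction v using loop_induction with
      | hadd v w hv hw =>
        rw [map_add, map_add, hv, hw, ← map_add, ← Finsupp.add_apply, ← map_add]
        rfl
      | h i a ha =>
        rw [loopEmbedding_loopMk, hΓ]
        change _ = ι (laurentCoeff k A (a ⊗ₜ T i) q)
        rw [laurentCoeff_tmul_T, Finsupp.single_apply]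
        split_ifs <;> simp
    rw [← key, hv]
    simp
  apply Subtype.ext
  exact (laurentCoeff k A).map_eq_zero_iff.1 h0

end Laurent

/-! ### Forms and perfectness pass to loop algebras. -/

section LoopForm

open LaurentPolynomial

variable {k : Type u} [Field k] {X : NAlg.{u} k} {S : Type u} [CommRing S] [Algebra k S]
  {A : Type u} [NonUnitalNonAssocRing A] [Module k A] [IsScalarTower k A A]
  [SMulCommClass k A A] {m : ℕ} [NeZero m] (G : Grading k A m) {ι : A →ₗ[k] S ⊗[k] X}

/-- The standard integer representative of a residue class. -/
def rep (i : ZMod m) : ℤ := (i.val : ℤ)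

theorem cast_rep (i : ZMod m) : ((rep i : ℤ) : ZMod m) = i := by
  simp [rep]

/-- The element `a_i ⊗ z ^ i` of the loop algebra, for the standard representative `i`. -/
noncomputable def loopRep (i : ZMod m) : A →ₗ[k] loopSubalgebra G where
  toFun a := loopMk G (rep i) (G.proj i a) (by rw [cast_rep]; exact G.proj_mem i a)
  map_add' a b := by
    apply Subtype.ext
    change G.proj i (a + b) ⊗ₜ[k] (T (rep i) : LaurentPolynomial k) =
      G.proj i a ⊗ₜ T (rep i) + G.proj i b ⊗ₜ T (rep i)
    rw [map_add, TensorProduct.add_tmul]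
  map_smul' c a := by
    apply Subtype.ext
    change G.proj i (c • a) ⊗ₜ[k] (T (rep i) : LaurentPolynomial k) =
      c • (G.proj i a ⊗ₜ T (rep i))
    rw [map_smul, TensorProduct.smul_tmul']

theorem loopEmbedding_loopRep (i : ZMod m) (a : A) :
    loopEmbedding G ι (loopRep G i a) = laurentMono (rep i) (ι (G.proj i a)) :=
  loopEmbedding_loopMk G ι _ _ (by rw [cast_rep]; exact G.proj_mem i a)

/-- The exponent must match the degree of `s` modulo `m`: then `a ⊗ z ^ i` goes to an element of
degree `i + j` times `z ^ (i + j)`, again in the loop algebra. -/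
theorem C_mul_T_mem_stabilizer {h : ZMod m} {s : S} (hs : s ∈ homogStabilizer G ι h) {j : ℤ}
    (hj : (j : ZMod m) = h) : (C s * T j : LaurentPolynomial S) ∈
      stabilizer (A := loopSubalgebra G) (loopEmbedding G ι) := by
  intro v
  induction v using loop_induction with
  | hadd v w hv hw =>
    obtain ⟨v', hv⟩ := hv
    obtain ⟨w', hw⟩ := hw
    exact ⟨v' + w', by rw [map_add, smul_add, hv, hw, map_add]⟩
  | h i a ha =>
    obtain ⟨b, hb, hab⟩ := hs _ a ha
    refine ⟨loopMk G (j + i) b (by rw [Int.cast_add, hj, add_comm]; exact hb), ?_⟩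
    rw [loopEmbedding_loopMk, loopEmbedding_loopMk, C_mul_T_smul_laurentMono, hab]

theorem one_mem_homogStabilizer : (1 : S) ∈ homogStabilizer G ι 0 :=
  fun i a ha => ⟨a, by rwa [add_zero], one_smul _ _⟩

theorem T_mem_stabilizer {j : ℤ} (hj : (j : ZMod m) = 0) :
    (T j : LaurentPolynomial S) ∈ stabilizer (A := loopSubalgebra G) (loopEmbedding G ι) := by
  simpa using C_mul_T_mem_stabilizer (ι := ι) G (one_mem_homogStabilizer G) hj

/-- Since `z` is invertible in the scalars, each homogeneous component of `a` is recovered from the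
loop algebra by a power of `z`. -/
theorem loopEmbedding_span (hι : Submodule.span S (Set.range ι) = ⊤) :
    Submodule.span (LaurentPolynomial S) (Set.range (loopEmbedding G ι)) = ⊤ := by
  set N := Submodule.span (LaurentPolynomial S) (Set.range (loopEmbedding G ι))
  have h1 (a : A) : laurentMono 0 (ι a) ∈ N := by
    rw [← G.sum_proj a, map_sum, map_sum]
    refine Submodule.sum_mem _ fun i _ => ?_
    have : laurentMono (S := S) 0 (ι (G.proj i a)) =
        (T (-rep i) : LaurentPolynomial S) • loopEmbedding G ι (loopRep G i a) := by
      rw [loopEmbedding_loopRep, T_smul_laurentMono, neg_add_cancel]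
    rw [this]
    exact N.smul_mem _ (Submodule.subset_span ⟨_, rfl⟩)
  have h2 (v : S ⊗[k] X) : laurentMono 0 v ∈ N := by
    have hv : v ∈ Submodule.span S (Set.range ι) := by rw [hι]; trivial
    induction hv using Submodule.span_induction with
    | mem v hv => obtain ⟨a, rfl⟩ := hv; exact h1 a
    | zero => rw [map_zero]; exact N.zero_mem
    | add v w _ _ hv hw => rw [map_add]; exact N.add_mem hv hw
    | smul s v _ hv => rw [← C_smul_laurentMono]; exact N.smul_mem _ hv
  rw [eq_top_iff]
  intro v _
  refine Submodule.span_le.2 ?_ (laurent_span v)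
  rintro _ ⟨w, rfl⟩
  exact h2 w

theorem IsSpanningEmbedding.loop (hι : IsSpanningEmbedding ι) :
    IsSpanningEmbedding (A := loopSubalgebra G) (loopEmbedding G ι) where
  map_mul := loopEmbedding_mul G hι.map_mul
  injective := loopEmbedding_injective G hι.injective
  span_range := loopEmbedding_span G hι.span_range

/-- Powers of `z` are integral because their `m`-th powers lie in the stabilizer. A scalar `c` of
degree `h` in the old stabilizer is `(c z ^ h) z ^ (-h)`, a product of integral elements.
Transitivity then reaches `S`. -/
theorem loopEmbedding_isIntegral [Module.Finite k X] (hc : IsCentralAlg k X)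
    (hs : IsSimpleAlg k X) (hι : IsSpanningEmbedding ι)
    (hint : ∀ s : S, IsIntegral (stabilizer ι) s) (p : LaurentPolynomial S) :
    IsIntegral (stabilizer (A := loopSubalgebra G) (loopEmbedding G ι)) p := by
  have hT (n : ℤ) : IsIntegral (stabilizer (A := loopSubalgebra G) (loopEmbedding G ι)) (T n : LaurentPolynomial S) := by
    refine IsIntegral.of_pow (Nat.pos_of_neZero m) ?_
    rw [T_pow]
    exact isIntegral_algebraMap (x := (⟨_, T_mem_stabilizer G (by simp)⟩ :
      stabilizer (A := loopSubalgebra G) (loopEmbedding G ι)))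
  have hstab (s : S) (h : s ∈ stabilizer ι) :
      IsIntegral (stabilizer (A := loopSubalgebra G) (loopEmbedding G ι)) (C s : LaurentPolynomial S) := by
    obtain ⟨c, hc, rfl⟩ := exists_sum_homogStabilizer G hc hs hι h
    rw [map_sum]
    refine IsIntegral.sum _ fun i _ => ?_
    have : (C (c i) : LaurentPolynomial S) = (C (c i) * T (rep i)) * T (-rep i) := by
      rw [mul_assoc, ← T_add, add_neg_cancel, T_zero, mul_one]
    rw [this]
    exact (isIntegral_algebraMap (x := (⟨_, C_mul_T_mem_stabilizer G (hc i) (cast_rep i)⟩ :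
      stabilizer (A := loopSubalgebra G) (loopEmbedding G ι)))).mul (hT _)
  have hC (s : S) : IsIntegral (stabilizer (A := loopSubalgebra G) (loopEmbedding G ι)) (C s : LaurentPolynomial S) := by
    let φ : stabilizer ι →+* integralClosure (stabilizer (A := loopSubalgebra G) (loopEmbedding G ι))
        (LaurentPolynomial S) :=
      ((C : S →+* LaurentPolynomial S).comp (stabilizer ι).val.toRingHom).codRestrict
        (integralClosure _ _) fun s => hstab s.1 s.2
    have : IsIntegral (integralClosure (stabilizer (A := loopSubalgebra G) (loopEmbedding G ι))
        (LaurentPolynomial S)) (C s : LaurentPolynomial S) :=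
      IsIntegral.map_of_comp_eq φ (C : S →+* LaurentPolynomial S) (RingHom.ext fun _ => rfl)
        (hint s)
    exact isIntegral_trans _ this
  induction p using LaurentPolynomial.induction_on' with
  | add p q hp hq => exact hp.add hq
  | C_mul_T n a => exact (hC a).mul (hT n)

/-- A scalar of degree `h` shifts homogeneous components by `h`, so both sides can be compared
component by component. -/
theorem smul_proj_eq {h : ZMod m} {s : S} (hι : Function.Injective ι)
    (hs : s ∈ homogStabilizer G ι h) {a b : A} (hab : s • ι a = ι b) (i : ZMod m) :
    s • ι (G.proj i a) = ι (G.proj (i + h) b) := by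
  choose c hc hc' using fun i => hs i (G.proj i a) (G.proj_mem i a)
  have hb : b = ∑ i, c i := by
    apply hι
    rw [← hab, map_sum, ← G.sum_proj a, map_sum, Finset.smul_sum]
    simp only [hc']
  rw [hc', hb, map_sum, Finset.sum_eq_single i, G.proj_of_mem (hc i)]
  · intro j _ hj
    exact G.proj_of_mem_of_ne (hc j) (by simpa using hj)
  · simp

/-- The generators are the homogeneous components of the old ones, each carried by the standard
power of `z`; other powers differ by a multiple of `m`, hence by a stabilizing scalar. -/
theorem loopEmbedding_fg [Module.Finite k X] (hc : IsCentralAlg k X)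
    (hs : IsSimpleAlg k X) (hι : IsSpanningEmbedding ι)
    (hfg : ∃ F : Set A, F.Finite ∧ ∀ a, ι a ∈ stabilizerSpan ι F) :
    ∃ F : Set (loopSubalgebra G), F.Finite ∧ ∀ a,
      loopEmbedding G ι a ∈ stabilizerSpan (A := loopSubalgebra G) (loopEmbedding G ι) F := by
  obtain ⟨F, hF, hFspan⟩ := hfg
  refine ⟨⋃ i, loopRep G i '' F, Set.finite_iUnion fun i => hF.image _, ?_⟩
  set N := stabilizerSpan (A := loopSubalgebra G) (loopEmbedding G ι) (⋃ i, loopRep G i '' F)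
  have key (v : S ⊗[k] X) (hv : v ∈ stabilizerSpan ι F) :
      ∃ a, ι a = v ∧ ∀ l : ℤ, laurentMono l (ι (G.proj (l : ZMod m) a)) ∈ N := by
    induction hv using Submodule.span_induction with
    | mem v hv =>
      obtain ⟨a, ha, rfl⟩ := hv
      refine ⟨a, rfl, fun l => ?_⟩
      have : laurentMono l (ι (G.proj (l : ZMod m) a)) =
          (T (l - rep (l : ZMod m)) : LaurentPolynomial S) •
            loopEmbedding G ι (loopRep G (l : ZMod m) a) := by
        rw [loopEmbedding_loopRep, T_smul_laurentMono, sub_add_cancel]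
      rw [this]
      refine smul_mem_stabilizerSpan (T_mem_stabilizer G ?_) (mem_stabilizerSpan _ ?_)
      · rw [Int.cast_sub, cast_rep, sub_self]
      · exact Set.mem_iUnion.2 ⟨_, a, ha, rfl⟩
    | zero => exact ⟨0, map_zero ι, fun l => by simp⟩
    | add v w _ _ hv hw =>
      obtain ⟨a, rfl, ha⟩ := hv
      obtain ⟨b, rfl, hb⟩ := hw
      refine ⟨a + b, map_add ι a b, fun l => ?_⟩
      simp only [map_add]
      exact N.add_mem (ha l) (hb l)
    | smul r v _ hv =>
      obtain ⟨a, rfl, ha⟩ := hv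
      obtain ⟨c, hc, hr⟩ := exists_sum_homogStabilizer G hc hs hι r.2
      choose b hb using fun h => homogStabilizer_subset G ι h (hc h) a
      refine ⟨∑ h, b h, ?_, fun l => ?_⟩
      · rw [map_sum, Subalgebra.smul_def, hr, Finset.sum_smul]
        exact Finset.sum_congr rfl fun h _ => (hb h).symm
      · simp only [map_sum]
        refine N.sum_mem fun h _ => ?_
        have h1 := smul_proj_eq G hι.injective (hc h) (hb h) ((l : ZMod m) - h)
        rw [sub_add_cancel] at h1
        -- With `c = c h` and `p = rep h`, the degree `l` part of `c a` is handled by writing `z ^ l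
        -- c a' = (c z ^ p) (z ^ (l - p) a')`, where `a'` is the component of `a` of degree `l - h`.
        -- The first factor stabilizes, the second is covered by induction.
        have h2 := C_mul_T_smul_laurentMono (k := k) (c h) (rep h) (l - rep h)
          (ι (G.proj ((l : ZMod m) - h) a))
        rw [add_sub_cancel, h1] at h2
        rw [← h2]
        refine smul_mem_stabilizerSpan (C_mul_T_mem_stabilizer G (hc h) (cast_rep h)) ?_
        simpa only [Int.cast_sub, cast_rep] using ha (l - rep h)
  intro v
  induction v using loop_induction with
  | hadd v w hv hw => rw [map_add]; exact N.add_mem hv hw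
  | h i a ha =>
    obtain ⟨b, hb, hb'⟩ := key _ (hFspan a)
    obtain rfl := hι.injective hb
    rw [loopEmbedding_loopMk]
    simpa only [G.proj_of_mem ha] using hb' i

/-- The map is built separately on each `z ^ q (S ⊗ X)` from the lifting property of `ι`. That `β`
is balanced over the new stabilizer gives balancedness over the old one, through its homogeneous
elements. -/
theorem loopEmbedding_exists_lift [Module.Finite k X] (hc : IsCentralAlg k X)
    (hs : IsSimpleAlg k X) (hι : IsForm ι) (P : Type u) [AddCommGroup P] [Module k P]
    (β : LaurentPolynomial S →ₗ[k] loopSubalgebra G →ₗ[k] P)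
    (hβ : ∀ s, ∀ r ∈ stabilizer (A := loopSubalgebra G) (loopEmbedding G ι), ∀ a b,
      r • loopEmbedding G ι a = loopEmbedding G ι b → β (s * r) a = β s b) :
    ∃ γ : LaurentPolynomial S ⊗[k] X →ₗ[k] P, ∀ s a, γ (s • loopEmbedding G ι a) = β s a := by
  let δ (q : ℤ) : S →ₗ[k] LaurentPolynomial S :=
    (AddMonoidAlgebra.coeffLinearEquiv k).symm.toLinearMap ∘ₗ Finsupp.lsingle (M := S) q
  have hδ (q : ℤ) (s : S) : δ q s = C s * T q := single_eq_C_mul_T s q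
  -- The value forced on `z ^ q s ι(a)`, obtained by writing it as the sum over `i` of `s z ^ (q -
  -- rep i)` times the loop element `a_i z ^ (rep i)`.
  let β' (q : ℤ) : S →ₗ[k] A →ₗ[k] P :=
    ∑ i : ZMod m, β.compl₁₂ (δ (q - rep i)) (loopRep G i)
  have hβ' (q : ℤ) (s : S) (a : A) :
      β' q s a = ∑ i : ZMod m, β (C s * T (q - rep i)) (loopRep G i a) := by
    simp [β', LinearMap.sum_apply, hδ]
  have hhom (q : ℤ) (s : S) {h : ZMod m} {c : S} (hc : c ∈ homogStabilizer G ι h) {a b : A}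
      (hab : c • ι a = ι b) : β' q (s * c) a = β' q s b := by
    rw [hβ', hβ']
    refine (Finset.sum_congr rfl fun i _ => ?_).trans (Equiv.sum_comp (Equiv.addRight h)
      fun j => β (C s * T (q - rep j)) (loopRep G j b))
    -- The exponent `rep (i + h) - rep i` is congruent to `h` but need not equal `rep h`; it carries
    -- one standard representative exactly to the other.
    have h1 := hβ (C s * T (q - rep (i + h))) (C c * T (rep (i + h) - rep i))
      (C_mul_T_mem_stabilizer G hc (by simp [cast_rep])) (loopRep G i a) (loopRep G (i + h) b)
      (by rw [loopEmbedding_loopRep, loopEmbedding_loopRep, C_mul_T_smul_laurentMono,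
        sub_add_cancel, smul_proj_eq G hι.injective hc hab])
    rw [mul_mul_mul_comm, ← T_add, sub_add_sub_cancel, ← map_mul] at h1
    exact h1

  have hγ (q : ℤ) : ∃ γ : S ⊗[k] X →ₗ[k] P, ∀ s a, γ (s • ι a) = β' q s a := by
    refine hι.exists_lift P (β' q) fun s r hr a b hab => ?_
    obtain ⟨c, hc, rfl⟩ := exists_sum_homogStabilizer G hc hs hι.toIsSpanningEmbedding hr
    choose d hd using fun h => homogStabilizer_subset G ι h (hc h) a
    have hb : b = ∑ h, d h := by
      apply hι.injective
      rw [← hab, Finset.sum_smul, map_sum]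
      exact Finset.sum_congr rfl fun h _ => hd h
    rw [Finset.mul_sum, map_sum, LinearMap.sum_apply, hb, map_sum]
    exact Finset.sum_congr rfl fun h _ => hhom q s (hc h) (hd h)
  choose γ hγ using hγ
  obtain ⟨Γ, hΓ⟩ := exists_laurent_lift γ
  refine ⟨Γ, fun p v => ?_⟩
  induction p using LaurentPolynomial.induction_on' with
  | add p q hp hq => rw [add_smul, map_add, hp, hq, map_add, LinearMap.add_apply]
  | C_mul_T n s =>
    induction v using loop_induction with
    | hadd v w hv hw => rw [map_add, smul_add, map_add, hv, hw, map_add]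
    | h l a ha =>
      rw [loopEmbedding_loopMk, C_mul_T_smul_laurentMono, hΓ, hγ, hβ',
        Finset.sum_eq_single (l : ZMod m)]
      -- Only the term of degree `l` survives; the power of `z` by which `l` differs from its
      -- standard representative is moved across `β`.
      · have h1 := hβ (C s * T n) (T (l - rep (l : ZMod m)))
          (T_mem_stabilizer G (by simp [cast_rep])) (loopRep G (l : ZMod m) a) (loopMk G l a ha)
          (by rw [loopEmbedding_loopRep, loopEmbedding_loopMk, T_smul_laurentMono,
            sub_add_cancel, G.proj_of_mem ha])
        rw [← h1, mul_assoc, ← T_add, add_sub_assoc]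
      · intro j _ hj
        have : loopRep G j a = 0 := by
          apply loopEmbedding_injective G hι.injective
          rw [loopEmbedding_loopRep, G.proj_of_mem_of_ne ha hj.symm]
          simp
        rw [this, map_zero]
      · simp

/-- A loop algebra of a form of `X` is a form of `X`. -/
theorem IsForm.loop [Module.Finite k X] (hc : IsCentralAlg k X) (hs : IsSimpleAlg k X)
    (hι : IsForm ι) : IsForm (A := loopSubalgebra G) (loopEmbedding G ι) where
  toIsSpanningEmbedding := hι.toIsSpanningEmbedding.loop G
  exists_lift := loopEmbedding_exists_lift G hc hs hι
  isIntegral := loopEmbedding_isIntegral G hc hs hι.toIsSpanningEmbedding hι.isIntegral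
  fg := loopEmbedding_fg G hc hs hι.toIsSpanningEmbedding hι.fg

/-- The degree `l` part of `a b` times `z ^ l` is the sum over `i` of `(a_i z ^ (rep i)) (b_{l - i}
z ^ (l - rep i))`, and each summand is a product in the loop algebra. -/
theorem isPerfectAlg_loop (hA : IsPerfectAlg k A) : IsPerfectAlg k (loopSubalgebra G) := by
  rw [IsPerfectAlg, eq_top_iff]
  intro v _
  set N := Submodule.span k (Set.range fun p : loopSubalgebra G × loopSubalgebra G => p.1 * p.2)
  have key (a : A) : ∀ l : ℤ, loopMk G l (G.proj l a) (G.proj_mem _ a) ∈ N := by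
    have ha : a ∈ Submodule.span k (Set.range fun p : A × A => p.1 * p.2) := by
      rw [hA]; trivial
    induction ha using Submodule.closure_induction with
    | zero =>
      intro l
      convert N.zero_mem
      apply Subtype.ext
      change G.proj l 0 ⊗ₜ[k] (T l : LaurentPolynomial k) = 0
      rw [map_zero, TensorProduct.zero_tmul]
    | add a b _ _ ha hb =>
      intro l
      convert N.add_mem (ha l) (hb l)
      apply Subtype.ext
      change G.proj l (a + b) ⊗ₜ[k] (T l : LaurentPolynomial k) =
        G.proj l a ⊗ₜ T l + G.proj l b ⊗ₜ T l
      rw [map_add, TensorProduct.add_tmul]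
    | smul_mem c a ha =>
      intro l
      obtain ⟨⟨a, b⟩, rfl⟩ := ha
      have : loopMk G l (G.proj l (c • (a * b))) (G.proj_mem _ _) = c • ∑ i : ZMod m,
          loopRep G i a * loopMk G (l - rep i) (G.proj ((l - rep i : ℤ) : ZMod m) b)
            (G.proj_mem _ b) := by
        apply Subtype.ext
        simp only [loopRep, LinearMap.coe_mk, AddHom.coe_mk, loopMk_mul]
        change _ = c • ((loopSubalgebra G).toSubmodule.subtype (∑ i : ZMod m, _))
        rw [map_sum]
        change G.proj l (c • (a * b)) ⊗ₜ[k] (T l : LaurentPolynomial k) =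
          c • ∑ i : ZMod m, (G.proj i a * G.proj _ b) ⊗ₜ[k] (T (rep i + (l - rep i)))
        simp only [add_sub_cancel]
        rw [← TensorProduct.sum_tmul, map_smul, TensorProduct.smul_tmul']
        congr 2
        nth_rw 1 [← G.sum_proj a]
        rw [Finset.sum_mul, map_sum]
        refine Finset.sum_congr rfl fun i _ => ?_
        have := G.proj_mul_of_mem_left (j := (l : ZMod m) - i) (G.proj_mem i a) b
        rw [add_sub_cancel] at this
        rw [this, Int.cast_sub, cast_rep]
      rw [this]
      exact N.smul_mem _ (N.sum_mem fun i _ => Submodule.subset_span ⟨(_, _), rfl⟩)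
  induction v using loop_induction with
  | hadd v w hv hw => exact N.add_mem (hv trivial) (hw trivial)
  | h i a ha =>
    have := key a i
    simpa only [G.proj_of_mem ha] using this

end LoopForm

theorem AlgIso.symm {B A A' : Type u} [CommRing B] [NonUnitalNonAssocRing A] [Module B A]
    [NonUnitalNonAssocRing A'] [Module B A'] (h : AlgIso B A A') : AlgIso B A' A := by
  obtain ⟨e, he⟩ := h
  refine ⟨e.symm, fun x y => e.injective ?_⟩
  simp [he]

theorem AlgIso.trans {B A A' A'' : Type u} [CommRing B] [NonUnitalNonAssocRing A] [Module B A]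
    [NonUnitalNonAssocRing A'] [Module B A'] [NonUnitalNonAssocRing A''] [Module B A'']
    (h : AlgIso B A A') (h' : AlgIso B A' A'') : AlgIso B A A'' := by
  obtain ⟨e, he⟩ := h
  obtain ⟨e', he'⟩ := h'
  exact ⟨e.trans e', fun x y => by simp [he, he']⟩

/-! ### Scalar extension of forms to fields, and transcendence degree. -/

section ScalarExtension

variable {k : Type u} [Field k] {X : NAlg.{u} k} {S : Type u} [CommRing S] [Algebra k S]
  {A : Type u} [NonUnitalNonAssocRing A] [Module k A] [IsScalarTower k A A]
  [SMulCommClass k A A]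

/-- The scalar extension of a form of `X` along a homomorphism to a field that extends to `S` is
the scalar extension of `X`. -/
theorem IsForm.algIso_tensor {ι : A →ₗ[k] S ⊗[k] X} (hι : IsForm ι) {R : Type u} [CommRing R]
    [Module R A] [IsScalarTower R A A] [SMulCommClass R A A] {K : Type u} [Field K]
    [Algebra k K] [Algebra R K] (ρ : R → S) (hρ : ∀ r a, ι (r • a) = ρ r • ι a)
    (hρ' : ∀ s ∈ stabilizer ι, ∃ r, ρ r = s)
    (hk : ∀ c : k, ∃ r : R, (∀ a : A, c • a = r • a) ∧ algebraMap R K r = algebraMap k K c)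
    (ψ : S →ₐ[k] K) (hψ : ∀ r, ψ (ρ r) = algebraMap R K r) :
    AlgIso K (K ⊗[R] A) (K ⊗[k] X) := by
  have : SMulCommClass R k K := ⟨fun r c x => by
    rw [Algebra.smul_def, Algebra.smul_def, Algebra.smul_def, Algebra.smul_def, mul_left_comm]⟩
  have hsmul (c : k) (v : K ⊗[R] A) : c • v = algebraMap k K c • v :=
    (algebraMap_smul K c v).symm
  -- The lifting property applied to this map gives `γ : S ⊗ X → K ⊗_R A`, the only nonformal
  -- ingredient of the inverse isomorphism.
  let β : S →ₗ[k] A →ₗ[k] K ⊗[R] A := LinearMap.mk₂ k (fun s a => ψ s ⊗ₜ[R] a)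
    (fun s t a => by rw [map_add, TensorProduct.add_tmul])
    (fun c s a => by rw [map_smul, hsmul, TensorProduct.smul_tmul', Algebra.smul_def]; rfl)
    (fun s a b => TensorProduct.tmul_add _ _ _)
    (fun c s a => by
      obtain ⟨r, hr, hr'⟩ := hk c
      rw [hr, hsmul, ← hr', ← TensorProduct.smul_tmul, TensorProduct.smul_tmul',
        Algebra.smul_def]; rfl)
  have hβ (s : S) (a : A) : β s a = ψ s ⊗ₜ a := rfl
  obtain ⟨γ, hγ⟩ := hι.exists_lift _ β (fun s r hr a b hab => by
    obtain ⟨r, rfl⟩ := hρ' r hr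
    rw [← hρ] at hab
    obtain rfl := hι.injective hab
    rw [hβ, hβ, map_mul, hψ, ← TensorProduct.smul_tmul, Algebra.smul_def, mul_comm])
  have hγ1 (a : A) : γ (ι a) = 1 ⊗ₜ a := by simpa [hβ] using hγ 1 a
  have hγs (s : S) (v : S ⊗[k] X) : γ (s • v) = ψ s • γ v := by
    induction v using hι.span_induction generalizing s with
    | h0 => simp
    | hadd v w hv hw => simp only [smul_add, map_add, hv, hw]
    | hsmul t v hv => rw [hv, ← mul_smul, hv, map_mul, mul_smul]
    | h a => rw [hγ, hγ1, hβ, TensorProduct.smul_tmul', smul_eq_mul, mul_one]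
  let Ψ : S ⊗[k] X →ₗ[k] K ⊗[k] X := LinearMap.rTensor X ψ.toLinearMap
  have hΨs (s : S) (v : S ⊗[k] X) : Ψ (s • v) = ψ s • Ψ v := by
    induction v with
    | zero => simp
    | add v w hv hw => simp only [smul_add, map_add, hv, hw]
    | tmul t x => simp [Ψ, TensorProduct.smul_tmul']
  have hΨmul (v w : S ⊗[k] X) : Ψ (v * w) = Ψ v * Ψ w := by
    induction v with
    | zero => simp
    | add v v' hv hv' => simp only [add_mul, map_add, hv, hv']
    | tmul t x =>
      induction w with
      | zero => simp
      | add v v' hv hv' => simp only [mul_add, map_add, hv, hv']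
      | tmul s y => simp [Ψ, Algebra.TensorProduct.tmul_mul_tmul]
  let f : K ⊗[R] A →+ K ⊗[k] X := TensorProduct.liftAddHom
    { toFun := fun c => ((DistribSMul.toAddMonoidHom (K ⊗[k] X) c).comp Ψ.toAddMonoidHom).comp
        ι.toAddMonoidHom
      map_zero' := by ext; simp
      map_add' := fun c d => by ext; simp [add_smul] }
    (fun r c a => by
      change (r • c) • Ψ (ι a) = c • Ψ (ι (r • a))
      rw [hρ, hΨs, hψ, Algebra.smul_def, mul_comm, mul_smul])
  have hf (c : K) (a : A) : f (c ⊗ₜ a) = c • Ψ (ι a) := rfl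
  have hfs (c : K) (v : K ⊗[R] A) : f (c • v) = c • f v := by
    induction v with
    | zero => simp
    | add v w hv hw => simp only [smul_add, map_add, hv, hw]
    | tmul d a => rw [TensorProduct.smul_tmul', hf, hf, smul_eq_mul, mul_smul]
  have hfmul (v w : K ⊗[R] A) : f (v * w) = f v * f w := by
    induction v with
    | zero => simp
    | add v v' hv hv' => simp only [add_mul, map_add, hv, hv']
    | tmul c a =>
      induction w with
      | zero => simp
      | add v v' hv hv' => simp only [mul_add, map_add, hv, hv']
      | tmul d b =>
        rw [Algebra.TensorProduct.tmul_mul_tmul, hf, hf, hf, hι.map_mul, hΨmul, mul_smul,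
          smul_mul_smul_comm, mul_smul]
  have hfγ (v : S ⊗[k] X) : f (γ v) = Ψ v := by
    induction v using hι.span_induction with
    | h0 => simp
    | hadd v w hv hw => simp only [map_add, hv, hw]
    | hsmul s v hv => rw [hγs, hfs, hv, hΨs]
    | h a => rw [hγ1, hf, one_smul]
  -- The inverse of `f`: the `K`-linear extension of `γ` restricted to `1 ⊗ X`.
  let g : K ⊗[k] X →+ K ⊗[R] A := TensorProduct.liftAddHom
    { toFun := fun c => (DistribSMul.toAddMonoidHom (K ⊗[R] A) c).comp
        (γ.toAddMonoidHom.comp (TensorProduct.mk k S X 1).toAddMonoidHom)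
      map_zero' := by ext; simp
      map_add' := fun c d => by ext; simp [add_smul] }
    (fun r c x => by
      change (r • c) • γ (1 ⊗ₜ x) = c • γ (1 ⊗ₜ (r • x))
      rw [TensorProduct.tmul_smul, map_smul, hsmul, Algebra.smul_def, mul_comm, mul_smul])
  have hg (c : K) (x : X) : g (c ⊗ₜ x) = c • γ (1 ⊗ₜ x) := rfl
  have hgs (c : K) (v : K ⊗[k] X) : g (c • v) = c • g v := by
    induction v with
    | zero => simp
    | add v w hv hw => simp only [smul_add, map_add, hv, hw]
    | tmul d a => rw [TensorProduct.smul_tmul', hg, hg, smul_eq_mul, mul_smul]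
  have hgΨ (v : S ⊗[k] X) : g (Ψ v) = γ v := by
    induction v with
    | zero => simp
    | add v w hv hw => simp only [map_add, hv, hw]
    | tmul s x =>
      change g (ψ s ⊗ₜ x) = _
      rw [hg, ← hγs, TensorProduct.smul_tmul', smul_eq_mul, mul_one]
  refine ⟨{ toFun := f, invFun := g, map_add' := map_add f, map_smul' := hfs,
            left_inv := fun v => ?_, right_inv := fun v => ?_ }, hfmul⟩
  · induction v with
    | zero => simp
    | add v w hv hw => simp only [map_add, hv, hw]
    | tmul c a =>
      rw [hf, hgs, hgΨ, hγ1, TensorProduct.smul_tmul', smul_eq_mul, mul_one]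
  · induction v with
    | zero => simp
    | add v w hv hw => simp only [map_add, hv, hw]
    | tmul c x =>
      rw [hg, hfs, hfγ]
      change c • (ψ 1 ⊗ₜ x) = _
      rw [map_one, TensorProduct.smul_tmul', smul_eq_mul, mul_one]

section Centroid

variable [Module.Finite k X]

/-- The centroid of `A` is the stabilizer of its image in `S ⊗ X`. -/
noncomputable def centroidEquiv (hc : IsCentralAlg k X)
    (hs : IsSimpleAlg k X) {ι : A →ₗ[k] S ⊗[k] X} (hι : IsSpanningEmbedding ι) :
    centroid k A ≃ₐ[k] stabilizer ι :=
  AlgEquiv.ofBijective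
    ((centroidHom hc hs hι).codRestrict (stabilizer ι) (centroidHom_mem_stabilizer hc hs hι))
    ⟨fun χ ψ h => centroidHom_injective hc hs hι (congrArg Subtype.val h), fun s => by
      obtain ⟨χ, hχ⟩ := exists_centroid_of_mem_stabilizer hc hs hι s.2
      exact ⟨χ, Subtype.ext hχ⟩⟩

/-- The centroid is the stabilizer, over which `S` is integral, so an embedding into an
algebraically closed field extends to `S`. -/
theorem IsForm.exists_extension [IsDomain S] (hc : IsCentralAlg k X)
    (hs : IsSimpleAlg k X) {ι : A →ₗ[k] S ⊗[k] X} (hι : IsForm ι)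
    {K : Type u} [Field K] [Algebra k K] [IsAlgClosed K] (φ : centroid k A →ₐ[k] K)
    (hφ : Function.Injective φ) :
    ∃ ψ : S →ₐ[k] K, ∀ χ, ψ (centroidHom hc hs hι.toIsSpanningEmbedding χ) = φ χ := by
  let e := centroidEquiv hc hs hι.toIsSpanningEmbedding
  let φ' : stabilizer ι →ₐ[k] K := φ.comp e.symm.toAlgHom
  have hφ' : Function.Injective φ' := hφ.comp e.symm.injective
  let _ : Algebra (stabilizer ι) K := φ'.toRingHom.toAlgebra
  have : FaithfulSMul (stabilizer ι) K :=
    (faithfulSMul_iff_algebraMap_injective _ _).2 hφ'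
  have : Module.IsTorsionFree (stabilizer ι) K := inferInstance
  have : Algebra.IsIntegral (stabilizer ι) S := ⟨hι.isIntegral⟩
  have : IsScalarTower k (stabilizer ι) K := IsScalarTower.of_algebraMap_eq fun c =>
    (φ'.commutes c).symm
  let ψ : S →ₐ[stabilizer ι] K := IsAlgClosed.lift
  refine ⟨ψ.restrictScalars k, fun χ => ?_⟩
  have := ψ.commutes (e χ)
  refine this.trans ?_
  change φ (e.symm (e χ)) = φ χ
  rw [e.symm_apply_apply]

theorem IsForm.centroidExtIso [IsDomain S] (hc : IsCentralAlg k X)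
    (hs : IsSimpleAlg k X) {ι : A →ₗ[k] S ⊗[k] X} (hι : IsForm ι)
    (h : IsPerfectAlg k A)
    {K : Type u} [Field K] [Algebra k K] [IsAlgClosed K] (φ : centroid k A →ₐ[k] K)
    (hφ : Function.Injective φ) : CentroidExtIso h φ X := by
  obtain ⟨ψ, hψ⟩ := IsForm.exists_extension hc hs hι φ hφ
  let _ : CommRing (centroid k A) := centroidCommRing h
  let _ : Algebra (centroid k A) K := φ.toRingHom.toAlgebra
  exact hι.algIso_tensor (centroidHom hc hs hι.toIsSpanningEmbedding)
    (map_centroid_apply hc hs hι.toIsSpanningEmbedding)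
    (fun s hs' => exists_centroid_of_mem_stabilizer hc hs hι.toIsSpanningEmbedding hs')
    (fun c => ⟨algebraMap k (centroid k A) c, fun a => rfl, φ.commutes c⟩) ψ hψ

/-- A zero `A` would force `0 = 1` in `S` by faithfulness. Finite generation over the stabilizer is
finite generation over the centroid. -/
theorem IsForm.isPfgc [Nontrivial S] (hc : IsCentralAlg k X)
    (hs : IsSimpleAlg k X) {ι : A →ₗ[k] S ⊗[k] X} (hι : IsForm ι)
    (h : IsPerfectAlg k A) : IsPfgc k A where
  nontrivial := by
    by_contra hA
    rw [not_nontrivial_iff_subsingleton] at hA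
    exact zero_ne_one (hι.smul_left_injective hs fun a => by
      rw [Subsingleton.elim a 0, map_zero, smul_zero, smul_zero])
  perfect := h
  finite := by
    obtain ⟨F, hF, hspan⟩ := hι.fg
    refine ⟨⟨hF.toFinset, ?_⟩⟩
    rw [hF.coe_toFinset, eq_top_iff]
    intro a _
    have key (v : S ⊗[k] X) (hv : v ∈ stabilizerSpan ι F) :
        ∃ a ∈ Submodule.span (centroid k A) F, ι a = v := by
      induction hv using Submodule.span_induction with
      | mem v hv =>
        obtain ⟨a, ha, rfl⟩ := hv
        exact ⟨a, Submodule.subset_span ha, rfl⟩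
      | zero => exact ⟨0, Submodule.zero_mem _, map_zero ι⟩
      | add v w _ _ hv hw =>
        obtain ⟨a, ha, rfl⟩ := hv
        obtain ⟨b, hb, rfl⟩ := hw
        exact ⟨a + b, Submodule.add_mem _ ha hb, map_add ι a b⟩
      | smul s v _ hv =>
        obtain ⟨a, ha, rfl⟩ := hv
        obtain ⟨χ, hχ⟩ := exists_centroid_of_mem_stabilizer hc hs hι.toIsSpanningEmbedding s.2
        refine ⟨χ • a, Submodule.smul_mem _ χ ha, ?_⟩
        change ι (χ.1 a) = s.1 • ι a
        rw [← hχ]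
        exact map_centroid_apply hc hs hι.toIsSpanningEmbedding χ a
    obtain ⟨b, hb, hab⟩ := key _ (hspan a)
    rwa [hι.injective hab] at hb

end Centroid

/-- Lets one algebra carry two forms, based on `X` and on `X'`, so that both can be compared through
the same centroid. -/
theorem IsForm.comp_equiv {ι : A →ₗ[k] S ⊗[k] X} (hι : IsForm ι) {A' : Type u}
    [NonUnitalNonAssocRing A'] [Module k A'] [IsScalarTower k A' A'] [SMulCommClass k A' A']
    (e : A' ≃ₗ[k] A) (he : ∀ x y, e (x * y) = e x * e y) :
    IsForm (ι ∘ₗ e.toLinearMap) := by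
  have hstab : stabilizer (ι ∘ₗ e.toLinearMap) = stabilizer ι := by
    ext s
    refine ⟨fun h a => ?_, fun h a => ?_⟩
    · obtain ⟨b, hb⟩ := h (e.symm a)
      exact ⟨e b, by simpa using hb⟩
    · obtain ⟨b, hb⟩ := h (e a)
      exact ⟨e.symm b, by simpa using hb⟩
  refine ⟨⟨fun a b => ?_, ?_, ?_⟩, fun P _ _ β hβ => ?_, ?_, ?_⟩
  · simp [he, hι.map_mul]
  · exact hι.injective.comp e.injective
  · rw [LinearMap.coe_comp, LinearEquiv.coe_coe, e.surjective.range_comp]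
    exact hι.span_range
  · obtain ⟨γ, hγ⟩ := hι.exists_lift P (β.compl₂ e.symm.toLinearMap) (fun s r hr a b hab =>
      hβ s r (hstab ▸ hr) (e.symm a) (e.symm b) (by simpa using hab))
    exact ⟨γ, fun s a => by simpa using hγ s (e a)⟩
  · rw [hstab]
    exact hι.isIntegral
  · obtain ⟨F, hF, hspan⟩ := hι.fg
    refine ⟨e.symm '' F, hF.image _, fun a => ?_⟩
    have := hspan (e a)
    have himg : (ι ∘ₗ e.toLinearMap) '' (e.symm '' F) = ι '' F := by
      rw [Set.image_image]; simp
    rw [stabilizerSpan, himg, hstab]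
    exact this

theorem IsForm.trdeg_stabilizer [IsDomain S] {ι : A →ₗ[k] S ⊗[k] X} (hι : IsForm ι) :
    Algebra.trdeg k (stabilizer ι) = Algebra.trdeg k S := by
  have : Algebra.IsIntegral (stabilizer ι) S := ⟨hι.isIntegral⟩
  rw [← trdeg_add_eq k (stabilizer ι) (A := S), trdeg_eq_zero (R := stabilizer ι), add_zero]

/-- The polynomial ring contributes `1`, and inverting the variable is an algebraic extension. -/
theorem trdeg_laurentPolynomial [IsDomain S] :
    Algebra.trdeg k (LaurentPolynomial S) = Algebra.trdeg k S + 1 := by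
  have : Algebra.IsAlgebraic (Polynomial S) (LaurentPolynomial S) :=
    IsLocalization.isAlgebraic _ (Submonoid.powers (Polynomial.X : Polynomial S))
  have : FaithfulSMul (Polynomial S) (LaurentPolynomial S) :=
    (faithfulSMul_iff_algebraMap_injective _ _).2 Polynomial.toLaurent_injective
  have : IsScalarTower S (Polynomial S) (LaurentPolynomial S) :=
    IsScalarTower.of_algebraMap_eq fun s => (Polynomial.toLaurent_C s).symm
  rw [← trdeg_add_eq k S (A := LaurentPolynomial S),
    ← trdeg_add_eq S (Polynomial S) (A := LaurentPolynomial S),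
    trdeg_eq_zero (R := Polynomial S), Polynomial.trdeg_of_isDomain, add_zero]

/-- An `n`-step loop algebra is a form of its base over a domain of transcendence degree `n`. -/
theorem IsIteratedLoop.exists_isForm {X L : NAlg.{u} k} {n : ℕ} (h : IsIteratedLoop X n L)
    [Module.Finite k X] (hc : IsCentralAlg k X) (hs : IsSimpleAlg k X) :
    ∃ (S : Type u) (_ : CommRing S) (_ : IsDomain S) (_ : Algebra k S) (ι : L →ₗ[k] S ⊗[k] X),
      IsForm ι ∧ Algebra.trdeg k S = n := by
  induction h with
  | zero => exact ⟨k, _, inferInstance, inferInstance, _, isForm_lid_symm X,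
    by rw [trdeg_eq_zero, Nat.cast_zero]⟩
  | succ hL hm G ih =>
    obtain ⟨S, _, _, _, ι, hι, htr⟩ := ih
    have : NeZero _ := ⟨hm.ne'⟩
    refine ⟨LaurentPolynomial S, inferInstance, inferInstance, inferInstance,
      loopEmbedding G ι, hι.loop G hc hs, ?_⟩
    rw [trdeg_laurentPolynomial, htr, Nat.cast_succ]

theorem IsIteratedLoop.isPerfectAlg {X L : NAlg.{u} k} {n : ℕ} (h : IsIteratedLoop X n L)
    (hs : IsSimpleAlg k X) : IsPerfectAlg k L := by
  induction h with
  | zero =>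
    obtain ⟨x, y, hxy⟩ := hs.1
    refine (hs.2 (Submodule.span k (Set.range fun p : X × X => p.1 * p.2)) fun a _ b =>
      ⟨Submodule.subset_span ⟨(b, a), rfl⟩, Submodule.subset_span ⟨(a, b), rfl⟩⟩).resolve_left
      fun h => hxy ?_
    rw [← Submodule.mem_bot k, ← h]
    exact Submodule.subset_span ⟨(x, y), rfl⟩
  | succ hL hm G ih =>
    have : NeZero _ := ⟨hm.ne'⟩
    exact isPerfectAlg_loop G ih

end ScalarExtension

end LoopAlg

/-! ### The type and the number of steps as invariants. -/

theorem corollary8p14 {k : Type u} [Field k]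
    (V : Set (FreeNonUnitalNonAssocAlgebra k ℕ))
    (hV : LoopAlg.IsHomogeneousVariety k V) (hS : LoopAlg.AxiomS k V)
    (𝕏 : Set (LoopAlg.NAlg.{u} k)) (h𝕏 : LoopAlg.IsArchetypes k V 𝕏)
    (X : LoopAlg.NAlg.{u} k) (hX : X ∈ 𝕏)
    (n : ℕ) (L : LoopAlg.NAlg.{u} k) (hL : LoopAlg.IsIteratedLoop X n L) :
    (∃ hp : LoopAlg.IsPfgc k L,
      LoopAlg.IsPrimeAlg k L ∧ LoopAlg.IsVAlg k V L ∧ LoopAlg.HasType 𝕏 hp.perfect X) ∧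
    ∀ (X' : LoopAlg.NAlg.{u} k), X' ∈ 𝕏 →
    ∀ (n' : ℕ) (L' : LoopAlg.NAlg.{u} k), LoopAlg.IsIteratedLoop X' n' L' →
      LoopAlg.AlgIso k L L' → X = X' ∧ n = n' := by
  obtain ⟨hfin, hc, hs, hXV⟩ := h𝕏.mem X hX
  obtain ⟨S, _, _, _, ι, hι, htr⟩ := hL.exists_isForm hc hs
  have hp := hL.isPerfectAlg hs
  -- The centroid embeds in the domain `S`, hence in this field; this supplies the embedding
  -- demanded by the definition of type.
  let K := AlgebraicClosure (FractionRing S)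
  have hK : Function.Injective (algebraMap S K) := by
    rw [IsScalarTower.algebraMap_eq S (FractionRing S) K]
    exact (algebraMap (FractionRing S) K).injective.comp (IsFractionRing.injective S _)
  let φ : LoopAlg.centroid k L →ₐ[k] K := (IsScalarTower.toAlgHom k S K).comp
    (LoopAlg.centroidHom hc hs hι.toIsSpanningEmbedding)
  have hφ : Function.Injective φ :=
    hK.comp (LoopAlg.centroidHom_injective hc hs hι.toIsSpanningEmbedding)
  refine ⟨⟨hι.isPfgc hc hs hp, hι.isPrimeAlg hc hs, hL.isVAlg hV hXV, hX,
    ⟨K, inferInstance, inferInstance, inferInstance, φ, hφ⟩,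
    fun K _ _ _ φ hφ => hι.centroidExtIso hc hs hp φ hφ, fun K _ _ _ φ hφ Y hY hiso => ?_⟩,
    fun X' hX' n' L' hL' hiso => ?_⟩
  · exact h𝕏.eq_of_iso K Y hY X hX (hiso.symm.trans (hι.centroidExtIso hc hs hp φ hφ))
  · obtain ⟨hfin', hc', hs', -⟩ := h𝕏.mem X' hX'
    obtain ⟨S', _, _, _, ι', hι', htr'⟩ := hL'.exists_isForm hc' hs'
    obtain ⟨e, he⟩ := hiso
    have hform := hι'.comp_equiv e he
    -- Both forms compute the same algebra `K ⊗_{C(L)} L` along the same `φ`, so (A2) applies.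
    refine ⟨h𝕏.eq_of_iso K X hX X' hX' ((hι.centroidExtIso hc hs hp φ hφ).symm.trans
      (hform.centroidExtIso hc' hs' hp φ hφ)), ?_⟩
    -- The two stabilizers are both the centroid of `L`; their transcendence degrees are `n` and
    -- `n'`.
    have := ((LoopAlg.centroidEquiv hc hs hι.toIsSpanningEmbedding).symm.trans
      (LoopAlg.centroidEquiv hc' hs' hform.toIsSpanningEmbedding)).trdeg_eq
    rw [hι.trdeg_stabilizer, hform.trdeg_stabilizer, htr, htr'] at this
    exact_mod_cast this
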